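/- Let $C\subseteq\mathbb F_2^n$ be a binary linear code of length $n$ and minimum distance $d$ that contains the all-ones vector $\mathbf 1_n$. Let $C^\perp$ be its dual code, of minimum distance $d^\perp$. For a weight $w$, let $D^\perp_w$ be the support design of $C^\perp$ for weight $w$: its points are the $n$ coordinates, and its blocks are the supports of the codewords of $C^\perp$ of weight $w$. It is an $s$-design if every $s$ points are contained in the same number of blocks (the number may be $0$). Let $t$ be such that $$d^\perp-t=\#\{u : 0<u\le n-t,\ C \text{ has a codeword of weight } u\}.$$ **(1)(a)** Let $(d^\perp,t)=(4,1)$. (i) Suppose $n^2-(4d+6)n+4d^2+32=0$. If $n\equiv 0\pmod 4$, then $D^\perp_6$ and $D^\perp_{n-6}$ are $2$-designs. If $n\equiv 2\pmod 4$, then $D^\perp_6$ is a $2$-design. (ii) If $n\equiv 2\pmod 4$, $d\equiv 0\pmod 2$ and $n^2-(4d+2)n+4d^2+8=0$, then $D^\perp_{n-4}$ is a $2$-design. (iii) If $$n^4-(8d+15)n^3+(12d(2d+5)+145)n^2-2\bigl(2d(d(8d+15)+100)+285\bigr)n+16(d^4+25d^2+109)=0,$$ then $D^\perp_8$ and $D^\perp_{n-8}$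 are $2$-designs. **(1)(b)** Let $(d^\perp,t)=(6,3)$. (i) Suppose $n^2-(4d+6)n+4d^2+56=0$. If $n\equiv 0\pmod 4$, then $D^\perp_8$ and $D^\perp_{n-8}$ are $4$-designs. If $n\equiv 2\pmod 4$, then $D^\perp_8$ is a $4$-design. (ii) If $n\equiv 2\pmod 4$, $d\equiv 0\pmod 2$ and $n^2-(4d+2)n+4d^2+16=0$, then $D^\perp_{n-6}$ is a $4$-design. (iii) If $$n^4-(8d+15)n^3+(12d(2d+5)+205)n^2-4d(d(8d+15)+160)n-930n+16d^2(d^2+40)+4744=0,$$ then $D^\perp_{10}$ and $D^\perp_{n-10}$ are $4$-designs. **(2)** Let $n-2d=6$. For either choice of sign: (a) If $(d^\perp,t)=(4,1)$, $u=\frac{3d-9\pm\sqrt{3d+1}}{4}$ is positive and $2u+8$ is an integer, then $D^\perp_{2u+8}$ is a $2$-design. (b) If $(d^\perp,t)=(6,3)$, $u=\frac{3d-15\pm\sqrt{3d-5}}{4}$ is positive and $2u+10$ is an integer, then $D^\perp_{2u+10}$ is a $4$-design. **(3)** Let $n-2d=8$. (a) If $(d^\perp,t)=(4,1)$ and $d$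 is a perfect square, then $D^\perp_{d+4+\sqrt d}$ and $D^\perp_{d+4-\sqrt d}$ are $2$-designs. (b) If $(d^\perp,t)=(6,3)$ and $d-2$ is a perfect square, then $D^\perp_{d+4+\sqrt{d-2}}$ and $D^\perp_{d+4-\sqrt{d-2}}$ are $4$-designs. -/

import Mathlib

/-- The support of a binary vector: the set of indices of its nonzero coordinates. -/
def binarySupport {n : ℕ} (c : Fin n → ZMod 2) : Finset (Fin n) :=
  Finset.univ.filter fun i => c i ≠ 0

/-- The dual code `{y | (x, y) = 0 for all x ∈ C}` for the standard inner product `∑ xᵢ yᵢ`. -/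
def dualCode {n : ℕ} (C : Submodule (ZMod 2) (Fin n → ZMod 2)) :
    Submodule (ZMod 2) (Fin n → ZMod 2) where
  carrier := {y | ∀ x ∈ C, ∑ i, x i * y i = 0}
  zero_mem' := by intro x _; simp
  add_mem' := by
    intro a b ha hb x hx
    simp only [Pi.add_apply, mul_add, Finset.sum_add_distrib]
    rw [ha x hx, hb x hx, add_zero]
  smul_mem' := by
    intro r a ha x hx
    simp only [Pi.smul_apply, smul_eq_mul, mul_left_comm _ r, ← Finset.mul_sum]
    rw [ha x hx, mul_zero]

/-- `d` is the minimum distance of `C`: the least weight of a nonzero codeword.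
In particular `C` has a nonzero codeword. -/
def HasMinDist {n : ℕ} (C : Submodule (ZMod 2) (Fin n → ZMod 2)) (d : ℕ) : Prop :=
  IsLeast {w : ℕ | ∃ c ∈ C, c ≠ 0 ∧ hammingNorm c = w} d

/-- `C` contains the all-ones vector, its dual has minimum distance `dperp`, and
`dperp - t = #{u | C_u ≠ ∅, 0 < u ≤ n - t}`, where `C_u` is the set of codewords of weight `u`. -/
structure IsAssmusMattson {n : ℕ} (C : Submodule (ZMod 2) (Fin n → ZMod 2)) (dperp t : ℕ) :
    Prop where
  one_mem : (fun _ => 1) ∈ C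
  dual_minDist : HasMinDist (dualCode C) dperp
  card_weights :
    (dperp : ℤ) - t = ({u : ℕ | (∃ c ∈ C, hammingNorm c = u) ∧ 0 < u ∧ u + t ≤ n}.ncard : ℤ)

/-- The blocks of the support design of `C` for weight `w`: the supports of the codewords of
weight `w`. -/
def supportDesign {n : ℕ} (C : Submodule (ZMod 2) (Fin n → ZMod 2)) (w : ℕ) :
    Set (Finset (Fin n)) :=
  {B | ∃ c ∈ C, hammingNorm c = w ∧ binarySupport c = B}

/-- `(X, B)` is a `t`-design: all blocks have the same size `k`, and any `t` points are contained
in precisely `l` blocks, for some `k` and `l`. -/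
def IsDesign {X : Type*} (t : ℕ) (B : Set (Finset X)) : Prop :=
  ∃ k l : ℕ, (∀ b ∈ B, b.card = k) ∧
    ∀ T : Finset X, T.card = t → {b ∈ B | T ⊆ b}.ncard = l

/-! Put k = t + 1, so that d^⊥ = k + 2. When t ≤ d, complementing by the all-ones word forces the
nonzero weights of C to lie among d, N = n/2, n - d and n (`IsAssmusMattson.isThreeWeight`). For a
set T of coordinates, sum the character of T over the codewords of each weight. By complement
symmetry only the sums at d and at N are unknown. Power moments of n - 2·wt twisted by T depend only
on #T while the degree plus #T stays below d^⊥. For #T < k this determines both unknowns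
(`weightSum_congr`). For #T = k one linear relation survives, so a single integer δ measures the
difference between two k-sets (`weightSum_sub`).

A MacWilliams identity for dual words whose support contains T turns this into generating functions.
For two k-sets, |C| times the difference of the enumerators is δ X^k (1 - X²)^(d-k) ((1+X)^(N-d) -
(1-X)^(N-d))² when k ≤ d; when k > d, δ vanishes. Hence D^⊥_w is a k-design as soon as one
coefficient of an explicit polynomial is zero (`IsThreeWeight.isDesign`).

Only even powers occur, so X² is replaced by X (`designPoly`). The conditions in the theorem say
that the coefficient of index 2 or 3, or its mirror image from the top, vanishes. For N - d = 3 or 4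
the polynomial factors and every coefficient is accessible. Mirroring these two coefficients needs N
- d even. In the quartic cases this comes from (N - d)² ≤ N for odd N - d (`sq_le_of_odd`), which
contradicts the quartic wherever the claim is not vacuous. For t = 3 and d ≤ 2 the reduction is
unavailable, and the hypotheses are shown to be contradictory. -/

open Finset Polynomial

/-! ### Characters and the MacWilliams transform -/

/-- The nontrivial additive character `ZMod 2 → {±1}`, with integer values. -/
def binarySign (a : ZMod 2) : ℤ := if a = 0 then 1 else -1

@[simp] lemma binarySign_zero : binarySign 0 = 1 := rfl

@[simp] lemma binarySign_one : binarySign 1 = -1 := rfl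

lemma binarySign_add (a b : ZMod 2) : binarySign (a + b) = binarySign a * binarySign b := by
  revert a b; decide

lemma binarySign_mul_self (a : ZMod 2) : binarySign a * binarySign a = 1 := by
  revert a; decide

lemma binarySign_sum {ι : Type*} (s : Finset ι) (f : ι → ZMod 2) :
    binarySign (∑ i ∈ s, f i) = ∏ i ∈ s, binarySign (f i) := by
  classical
  induction s using Finset.induction_on with
  | empty => simp
  | insert a s ha ih => rw [sum_insert ha, prod_insert ha, binarySign_add, ih]

section Code

variable {n : ℕ} (C : Submodule (ZMod 2) (Fin n → ZMod 2))

open Classical in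
/-- The codewords of `C` as a finite set. -/
noncomputable def codewords : Finset (Fin n → ZMod 2) := univ.filter (· ∈ C)

@[simp] lemma mem_codewords {c : Fin n → ZMod 2} : c ∈ codewords C ↔ c ∈ C := by
  simp [codewords]

lemma codewords_card_pos : 0 < #(codewords C) :=
  card_pos.2 ⟨0, by simp⟩

lemma sum_codewords_add {R : Type*} [AddCommMonoid R] {a : Fin n → ZMod 2} (ha : a ∈ C)
    (f : (Fin n → ZMod 2) → R) :
    ∑ c ∈ codewords C, f (c + a) = ∑ c ∈ codewords C, f c := by
  refine sum_bij' (fun c _ => c + a) (fun c _ => c - a) ?_ ?_ ?_ ?_ ?_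
  · intro c hc; simpa using C.add_mem ((mem_codewords C).1 hc) ha
  · intro c hc; simpa using C.sub_mem ((mem_codewords C).1 hc) ha
  all_goals simp

-- Orthogonality: if y is not in the dual, translating by a codeword a with (a, y) = 1 negates the
-- sum.
open Classical in
lemma sum_codewords_binarySign (y : Fin n → ZMod 2) :
    ∑ c ∈ codewords C, binarySign (∑ i, c i * y i) =
      if y ∈ dualCode C then (#(codewords C) : ℤ) else 0 := by
  split_ifs with hy
  · rw [sum_congr rfl (g := fun _ => (1 : ℤ))]
    · simp
    · intro c hc
      rw [hy c ((mem_codewords C).1 hc), binarySign_zero]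
  · have : ∃ a ∈ C, ∑ i, a i * y i ≠ 0 := by
      by_contra! h
      exact hy h
    obtain ⟨a, ha, hay⟩ := this
    have h1 : ∑ i, a i * y i = 1 := by
      revert hay
      generalize ∑ i, a i * y i = b
      revert b; decide
    have h := sum_codewords_add C ha (fun c => binarySign (∑ i, c i * y i))
    simp only [Pi.add_apply, add_mul, sum_add_distrib, binarySign_add, h1, binarySign_one,
      mul_neg, mul_one, sum_neg_distrib] at h
    omega

/-- The MacWilliams identity for products of local weights. -/
lemma macWilliams_prod {R : Type*} [CommRing R] (g : Fin n → ZMod 2 → R) :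
    (#(codewords C) : R) * ∑ y ∈ codewords (dualCode C), ∏ i, g i (y i) =
      ∑ c ∈ codewords C, ∏ i, (g i 0 + (binarySign (c i) : R) * g i 1) := by
  classical
  have h1 : ∀ c : Fin n → ZMod 2, ∏ i, (g i 0 + (binarySign (c i) : R) * g i 1) =
      ∑ y : Fin n → ZMod 2, (binarySign (∑ i, c i * y i) : R) * ∏ i, g i (y i) := by
    intro c
    have : ∀ i, g i 0 + (binarySign (c i) : R) * g i 1 =
        ∑ b ∈ (univ : Finset (ZMod 2)), (binarySign (c i * b) : R) * g i b := by
      intro i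
      have hu : (univ : Finset (ZMod 2)) = {0, 1} := by decide
      rw [hu, sum_pair (by decide)]
      simp
    simp_rw [this]
    rw [prod_univ_sum, Fintype.piFinset_univ]
    refine sum_congr rfl fun y _ => ?_
    rw [prod_mul_distrib, binarySign_sum, Int.cast_prod]
  simp_rw [h1]
  rw [sum_comm]
  simp_rw [← sum_mul, ← Int.cast_sum, sum_codewords_binarySign]
  rw [mul_sum, ← sum_subset (subset_univ (codewords (dualCode C)))]
  · refine sum_congr rfl fun y hy => ?_
    rw [if_pos ((mem_codewords _).1 hy)]; simp
  · intro y _ hy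
    rw [if_neg (by simpa using hy)]; simp

end Code

/-! ### Power moments twisted by characters -/

section Character

variable {n : ℕ}

/-- The character of `𝔽₂ⁿ` attached to the indicator vector of `T`. -/
def setSign (T : Finset (Fin n)) (c : Fin n → ZMod 2) : ℤ := ∏ i ∈ T, binarySign (c i)

@[simp] lemma setSign_empty (c : Fin n → ZMod 2) : setSign ∅ c = 1 := by simp [setSign]

lemma sum_binarySign (c : Fin n → ZMod 2) :
    ∑ i, binarySign (c i) = (n : ℤ) - 2 * hammingNorm c := by
  have : ∀ i, binarySign (c i) = 1 - 2 * (if c i ≠ 0 then 1 else 0) := by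
    intro i
    generalize c i = b
    revert b; decide
  simp_rw [this, sum_sub_distrib, ← mul_sum, sum_boole]
  simp [hammingNorm]

/-- The indicator vector of `T` plus the sum of the unit vectors `e_{f s}`. -/
def shiftedIndicator {a : ℕ} (T : Finset (Fin n)) (f : Fin a → Fin n) : Fin n → ZMod 2 :=
  fun i => (if i ∈ T then 1 else 0) + ∑ s, if f s = i then 1 else 0

lemma hammingNorm_shiftedIndicator_le {a : ℕ} (T : Finset (Fin n)) (f : Fin a → Fin n) :
    hammingNorm (shiftedIndicator T f) ≤ #T + a := by
  have : (univ.filter fun i => shiftedIndicator T f i ≠ 0) ⊆ T ∪ univ.image f := by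
    intro i hi
    by_contra h
    simp only [mem_union, mem_image, mem_univ, true_and, not_or, not_exists] at h
    simp [shiftedIndicator, h.1, h.2] at hi
  calc hammingNorm (shiftedIndicator T f) ≤ #(T ∪ univ.image f) := card_le_card this
    _ ≤ #T + #(univ.image f) := card_union_le _ _
    _ ≤ #T + a := by
      have := card_image_le (s := univ) (f := f)
      simp at this; omega

/-- Since n - 2·wt is the sum of the n coordinate characters, its a-th power expands over the maps
f, each term again being a character. -/
lemma setSign_mul_sum_pow (T : Finset (Fin n)) (a : ℕ) (c : Fin n → ZMod 2) :
    setSign T c * ((n : ℤ) - 2 * hammingNorm c) ^ a =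
      ∑ f : Fin a → Fin n, binarySign (∑ i, c i * shiftedIndicator T f i) := by
  rw [← sum_binarySign, Fintype.sum_pow, mul_sum]
  refine sum_congr rfl fun f _ => ?_
  simp only [shiftedIndicator, mul_add, sum_add_distrib, binarySign_add, mul_ite, mul_one,
    mul_zero, mul_sum]
  rw [← sum_filter, filter_mem_eq_inter, univ_inter, sum_comm, binarySign_sum, binarySign_sum]
  simp [setSign]

variable (C : Submodule (ZMod 2) (Fin n → ZMod 2))

-- The vectors in the expansion have weight at most #T + a < D, so such a vector lies in the dual
-- only if it is zero.
open Classical in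
lemma sum_setSign_mul_pow {D : ℕ} (hD : ∀ y ∈ dualCode C, y ≠ 0 → D ≤ hammingNorm y)
    {T : Finset (Fin n)} {a : ℕ} (hT : #T + a < D) :
    ∑ c ∈ codewords C, setSign T c * ((n : ℤ) - 2 * hammingNorm c) ^ a =
      ∑ f : Fin a → Fin n, if shiftedIndicator T f = 0 then (#(codewords C) : ℤ) else 0 := by
  simp_rw [setSign_mul_sum_pow]
  rw [sum_comm]
  refine sum_congr rfl fun f _ => ?_
  rw [sum_codewords_binarySign]
  congr 1
  refine propext ⟨fun h => ?_, fun h => h ▸ Submodule.zero_mem _⟩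
  by_contra h0
  have := hD _ h h0
  have := hammingNorm_shiftedIndicator_le T f
  omega

/-- Power moments of the weight against characters `T` with `#T + a` below the dual distance
depend only on `#T`. -/
lemma sum_setSign_mul_pow_congr {D : ℕ} (hD : ∀ y ∈ dualCode C, y ≠ 0 → D ≤ hammingNorm y)
    {T T' : Finset (Fin n)} {a : ℕ} (hT : #T + a < D) (hTT' : #T = #T') :
    ∑ c ∈ codewords C, setSign T c * ((n : ℤ) - 2 * hammingNorm c) ^ a =
      ∑ c ∈ codewords C, setSign T' c * ((n : ℤ) - 2 * hammingNorm c) ^ a := by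
  classical
  rw [sum_setSign_mul_pow C hD hT, sum_setSign_mul_pow C hD (hTT' ▸ hT)]
  -- Relabelling coordinates by σ matches the maps f that annihilate T with those that annihilate
  -- T'.
  obtain ⟨σ, rfl⟩ : ∃ σ : Equiv.Perm (Fin n), T.map σ.toEmbedding = T' := by
    exact Equiv.Perm.exists_map_finset_eq T T' hTT'
  refine Fintype.sum_equiv (Equiv.arrowCongr (Equiv.refl _) σ) _ _ fun f => ?_
  congr 1
  have : ∀ i, shiftedIndicator (T.map σ.toEmbedding)
      (Equiv.arrowCongr (Equiv.refl _) σ f) (σ i) = shiftedIndicator T f i := by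
    intro i
    simp [shiftedIndicator]
  refine propext ⟨fun h => ?_, fun h => ?_⟩
  · ext i
    obtain ⟨j, rfl⟩ := σ.surjective i
    rw [this, h]; rfl
  · ext i
    rw [← this, h]; rfl

/-- The second moment counts the pairs (i, j) with e_i + e_j = 0, which are the n diagonal ones. -/
lemma sum_sq_weight {D : ℕ} (hD : ∀ y ∈ dualCode C, y ≠ 0 → D ≤ hammingNorm y) (h3 : 3 ≤ D) :
    ∑ c ∈ codewords C, ((n : ℤ) - 2 * hammingNorm c) ^ 2 = (n : ℤ) * (#(codewords C) : ℤ) := by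
  classical
  have h := sum_setSign_mul_pow C hD (T := ∅) (a := 2) (by simp; omega)
  simp only [setSign_empty, one_mul] at h
  rw [h, Fintype.sum_equiv (finTwoArrowEquiv _) _ (fun q : Fin n × Fin n =>
    if q.1 = q.2 then (#(codewords C) : ℤ) else 0), Fintype.sum_prod_type]
  · simp
  · intro f
    congr 1
    refine propext ⟨fun h => ?_, fun h => ?_⟩
    · by_contra h01
      have h01 : f 0 ≠ f 1 := h01
      have := congrFun h (f 0)
      simp only [shiftedIndicator, Fin.sum_univ_two, notMem_empty, if_false, if_true, zero_add,
        if_neg h01.symm, add_zero, Pi.zero_apply, one_ne_zero] at this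
    · have h01 : f 0 = f 1 := h
      funext i
      simp only [shiftedIndicator, Fin.sum_univ_two, h01, notMem_empty, if_false, zero_add,
        Pi.zero_apply]
      split_ifs <;> decide

lemma setSign_univ (c : Fin n → ZMod 2) : setSign univ c = (-1) ^ hammingNorm c := by
  have : ∀ i, binarySign (c i) = if c i ≠ 0 then -1 else 1 := by
    intro i
    generalize c i = b
    revert b; decide
  simp_rw [setSign, this, prod_ite]
  simp [hammingNorm]

lemma sum_neg_one_pow_weight {a : Fin n → ZMod 2} (ha : a ∈ C) (hodd : Odd (hammingNorm a)) :
    ∑ c ∈ codewords C, (-1 : ℤ) ^ hammingNorm c = 0 := by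
  have h := sum_codewords_add C ha (fun c => setSign univ c)
  have h2 : ∀ c, setSign univ (c + a) = - setSign univ c := by
    intro c
    have := setSign_univ a
    rw [hodd.neg_one_pow] at this
    have h3 : setSign univ (c + a) = setSign univ c * setSign univ a := by
      simp [setSign, binarySign_add, prod_mul_distrib]
    rw [h3, this]; ring
  simp_rw [h2, sum_neg_distrib] at h
  simp_rw [← setSign_univ]
  omega

end Character

/-! ### Complement symmetry of character sums by weight -/

section WeightSum

variable {n : ℕ} (C : Submodule (ZMod 2) (Fin n → ZMod 2))

lemma hammingNorm_add_one (c : Fin n → ZMod 2) :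
    hammingNorm (c + fun _ => 1) = n - hammingNorm c := by
  have h := card_filter_add_card_filter_not (s := (univ : Finset (Fin n))) (fun i => c i ≠ 0)
  have h2 : hammingNorm (c + fun _ => 1) = #(univ.filter fun i => ¬ (c i ≠ 0)) := by
    unfold hammingNorm
    congr 1
    ext i
    simp only [mem_filter, mem_univ, true_and, Pi.add_apply]
    have : ∀ b : ZMod 2, b + 1 ≠ 0 ↔ ¬ (b ≠ 0) := by decide
    exact this (c i)
  rw [h2]
  simp only [card_univ, Fintype.card_fin] at h
  have h3 : hammingNorm c = #(univ.filter fun i => c i ≠ 0) := rfl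
  omega

lemma hammingNorm_le_length (c : Fin n → ZMod 2) : hammingNorm c ≤ n := by
  simpa using hammingNorm_le_card_fintype (x := c)

lemma setSign_add_one (T : Finset (Fin n)) (c : Fin n → ZMod 2) :
    setSign T (c + fun _ => 1) = (-1) ^ #T * setSign T c := by
  simp [setSign, binarySign_add, prod_neg]

/-- The sum of the character of `T` over the codewords of weight `u`. -/
noncomputable def weightSum (T : Finset (Fin n)) (u : ℕ) : ℤ :=
  ∑ c ∈ (codewords C).filter (fun c => hammingNorm c = u), setSign T c

lemma weightSum_zero (T : Finset (Fin n)) : weightSum C T 0 = 1 := by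
  have : (codewords C).filter (fun c => hammingNorm c = 0) = {0} := by
    ext c
    simp only [mem_filter, mem_codewords, hammingNorm_eq_zero, mem_singleton]
    exact ⟨fun h => h.2, fun h => ⟨h ▸ C.zero_mem, h⟩⟩
  rw [weightSum, this]
  simp [setSign]

lemma weightSum_compl (h1 : (fun _ => 1) ∈ C) (T : Finset (Fin n)) {u : ℕ} (hu : u ≤ n) :
    weightSum C T (n - u) = (-1) ^ #T * weightSum C T u := by
  simp only [weightSum, sum_filter]
  rw [← sum_codewords_add C h1, mul_sum]
  refine sum_congr rfl fun c _ => ?_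
  have := hammingNorm_le_length c
  rw [hammingNorm_add_one, setSign_add_one]
  have h2 : n - hammingNorm c = n - u ↔ hammingNorm c = u := by omega
  simp [h2]

end WeightSum

/-! ### Codes with inner weights d, N, n - d -/

/-- A binary code of even length `2N` containing the all-ones vector, all of whose weights are
`0, d, N, 2N - d, 2N`, and whose dual distance is at least `k + 2`. -/
structure IsThreeWeight {n : ℕ} (C : Submodule (ZMod 2) (Fin n → ZMod 2)) (k d N : ℕ) : Prop where
  one_mem : (fun _ => 1) ∈ C
  le_dual : ∀ y ∈ dualCode C, y ≠ 0 → k + 2 ≤ hammingNorm y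
  length_eq : n = 2 * N
  pos : 0 < d
  lt : d < N
  even : Even k
  weights : ∀ c ∈ C, hammingNorm c ∈ ({0, d, N, n - d, n} : Finset ℕ)

namespace IsThreeWeight

variable {n k d N : ℕ} {C : Submodule (ZMod 2) (Fin n → ZMod 2)}

lemma sum_setSign_mul (h : IsThreeWeight C k d N) {R : Type*} [CommRing R] (T : Finset (Fin n))
    (f : ℕ → R) :
    ∑ c ∈ codewords C, (setSign T c : R) * f (hammingNorm c) =
      f 0 + (-1) ^ #T * f n + weightSum C T d * (f d + (-1) ^ #T * f (n - d)) +
        weightSum C T N * f N := by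
  have h1 := h.length_eq
  have h2 := h.pos
  have h3 := h.lt
  rw [← sum_fiberwise_of_maps_to (g := hammingNorm) (t := {0, d, N, n - d, n})
    (fun c hc => h.weights c ((mem_codewords C).1 hc))]
  have key : ∀ u, ∑ c ∈ (codewords C).filter (fun c => hammingNorm c = u),
      (setSign T c : R) * f (hammingNorm c) = weightSum C T u * f u := by
    intro u
    rw [weightSum, Int.cast_sum, sum_mul]
    refine sum_congr rfl fun c hc => ?_
    rw [(mem_filter.1 hc).2]
  simp_rw [key]
  rw [sum_insert, sum_insert, sum_insert, sum_insert, sum_singleton]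
  · have e1 := weightSum_compl C h.one_mem T (u := d) (by omega)
    have e2 := weightSum_compl C h.one_mem T (u := 0) (by omega)
    rw [Nat.sub_zero] at e2
    rw [e1, e2, weightSum_zero]
    push_cast
    ring
  all_goals simp only [mem_insert, mem_singleton]; omega

/-- Moments 0, 1 and 2 are available because #T + 2 < k + 2. Weight N contributes nothing to moments
1 and 2, so one of these isolates the sum at d (the second if #T is even, the first if it is odd).
Moment 0 then gives the sum at N. -/
lemma weightSum_congr (h : IsThreeWeight C k d N) {T T' : Finset (Fin n)} (hT : #T = #T')
    (hk : #T < k) : weightSum C T d = weightSum C T' d ∧ weightSum C T N = weightSum C T' N := by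
  have h3 := h.lt
  have key : ∀ a, a ≤ 2 → _ := fun a ha =>
    sum_setSign_mul_pow_congr C h.le_dual (T := T) (T' := T') (a := a) (by omega) hT
  have h0 := key 0 (by norm_num)
  have h1 := key 1 (by norm_num)
  have h2 := key 2 (by norm_num)
  have hs := fun T : Finset (Fin n) => fun a : ℕ => h.sum_setSign_mul (R := ℤ) T
    (fun u => ((n : ℤ) - 2 * u) ^ a)
  simp only [Int.cast_id] at hs
  rw [hs, hs, hT] at h0 h1 h2
  have hp : (0 : ℤ) < N - d := by omega
  have hN : (n : ℤ) = 2 * N := by have := h.length_eq; omega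
  have hnd : ((n - d : ℕ) : ℤ) = 2 * N - d := by have := h.length_eq; omega
  rw [hnd, hN] at h0 h1 h2
  rcases neg_one_pow_eq_or ℤ #T' with e | e
  · rw [e] at h0 h2
    have : (weightSum C T d - weightSum C T' d) * (8 * (N - d : ℤ) ^ 2) = 0 := by
      linear_combination h2
    have h4 : weightSum C T d = weightSum C T' d := by
      rcases mul_eq_zero.1 this with h' | h'
      · omega
      · have := pow_pos hp 2; omega
    refine ⟨h4, ?_⟩
    rw [h4] at h0
    linear_combination h0
  · rw [e] at h0 h1
    have : (weightSum C T d - weightSum C T' d) * (4 * (N - d : ℤ)) = 0 := by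
      linear_combination h1
    have h4 : weightSum C T d = weightSum C T' d := by
      rcases mul_eq_zero.1 this with h' | h' <;> omega
    refine ⟨h4, ?_⟩
    rw [h4] at h0
    linear_combination h0

/-- At #T = k the second moment is lost. Moment 0 counts d and n - d with the same sign because k is
even, whence the factor 2. -/
lemma weightSum_sub (h : IsThreeWeight C k d N) {T T' : Finset (Fin n)} (hT : #T = k)
    (hT' : #T' = k) :
    weightSum C T N - weightSum C T' N = -2 * (weightSum C T d - weightSum C T' d) := by
  have h0 := sum_setSign_mul_pow_congr C h.le_dual (T := T) (T' := T') (a := 0) (by omega)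
    (by omega)
  have hs := fun T : Finset (Fin n) => fun a : ℕ => h.sum_setSign_mul (R := ℤ) T
    (fun u => ((n : ℤ) - 2 * u) ^ a)
  simp only [Int.cast_id] at hs
  rw [hs, hs, hT, hT', h.even.neg_one_pow] at h0
  linear_combination h0

end IsThreeWeight

/-! ### Generating function of the blocks through a given set -/

section Generating

variable {n : ℕ} (C : Submodule (ZMod 2) (Fin n → ZMod 2))

/-- The weight enumerator of the codewords whose support contains `T`. -/
noncomputable def supersetEnumerator (T : Finset (Fin n)) : ℤ[X] :=
  ∑ y ∈ (codewords C).filter (fun y => T ⊆ binarySupport y), X ^ hammingNorm y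

lemma prod_one_add_binarySign (c : Fin n → ZMod 2) :
    ∏ i, (1 + ((binarySign (c i) : ℤ) : ℤ[X]) * X) =
      (1 + X) ^ (n - hammingNorm c) * (1 - X) ^ hammingNorm c := by
  have : ∀ i, (1 + ((binarySign (c i) : ℤ) : ℤ[X]) * X) = if c i ≠ 0 then 1 - X else 1 + X := by
    intro i
    by_cases hc : c i = 0 <;> simp [hc, binarySign, sub_eq_add_neg]
  simp_rw [this, prod_ite, prod_const]
  have h2 := card_filter_add_card_filter_not (s := (univ : Finset (Fin n))) (fun i => c i ≠ 0)
  simp only [card_univ, Fintype.card_fin] at h2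
  have h3 : hammingNorm c = #(univ.filter fun i => c i ≠ 0) := rfl
  rw [h3, mul_comm]
  congr 2
  omega

/-- Give a zero coordinate in T the local weight 0. The transformed factor at i ∈ T is then χX with
χ = ±1, where an unrestricted coordinate has 1 + χX. Multiplying by 1 - X² = (1 + χX)(1 - χX)
restores the full product and leaves X(χ - X) for each i ∈ T, which expands over the subsets U of T.
-/
lemma macWilliams_supersetEnumerator (T : Finset (Fin n)) :
    (1 - X ^ 2) ^ #T * ((#(codewords C) : ℤ[X]) * supersetEnumerator (dualCode C) T) =
      X ^ #T * ∑ U ∈ T.powerset, (-X) ^ (#T - #U) *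
        ∑ c ∈ codewords C, (setSign U c : ℤ[X]) *
          ((1 + X) ^ (n - hammingNorm c) * (1 - X) ^ hammingNorm c) := by
  classical
  have hmac := macWilliams_prod C (R := ℤ[X]) (fun i b =>
    if b = 0 then (if i ∈ T then 0 else 1) else X)
  have hl : supersetEnumerator (dualCode C) T = ∑ y ∈ codewords (dualCode C),
      ∏ i, (if y i = 0 then (if i ∈ T then 0 else 1) else (X : ℤ[X])) := by
    rw [supersetEnumerator, sum_filter]
    refine sum_congr rfl fun y _ => ?_
    split_ifs with hy
    · have : ∀ i, (if y i = 0 then (if i ∈ T then 0 else 1) else (X : ℤ[X])) =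
          if y i ≠ 0 then X else 1 := by
        intro i
        by_cases hi : y i = 0
        · have : i ∉ T := fun hT => by simpa [binarySupport, hi] using hy hT
          simp [hi, this]
        · simp [hi]
      simp_rw [this, prod_ite]
      simp [hammingNorm]
    · obtain ⟨i, hi, hi'⟩ := not_subset.1 hy
      refine (prod_eq_zero (mem_univ i) ?_).symm
      have : y i = 0 := by simpa [binarySupport] using hi'
      simp [this, hi]
  rw [hl, hmac, mul_sum]
  simp_rw [mul_sum]
  rw [sum_comm]
  refine sum_congr rfl fun c _ => ?_
  have hsq : ∀ i, (1 - X ^ 2 : ℤ[X]) = (1 + ((binarySign (c i) : ℤ) : ℤ[X]) * X) *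
      (1 - ((binarySign (c i) : ℤ) : ℤ[X]) * X) := by
    intro i
    have : ((binarySign (c i) : ℤ) : ℤ[X]) * ((binarySign (c i) : ℤ) : ℤ[X]) = 1 := by
      rw [← Int.cast_mul, binarySign_mul_self, Int.cast_one]
    linear_combination (-X ^ 2) * (-this)
  have e1 : (1 - X ^ 2 : ℤ[X]) ^ #T = ∏ i, if i ∈ T then (1 + ((binarySign (c i) : ℤ) : ℤ[X]) * X) *
      (1 - ((binarySign (c i) : ℤ) : ℤ[X]) * X) else 1 := by
    rw [prod_ite_mem, univ_inter, ← prod_const]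
    exact prod_congr rfl fun i _ => hsq i
  have e2 : ∑ U ∈ T.powerset, X ^ #T * ((-X) ^ (#T - #U) * ((setSign U c : ℤ[X]) *
      ((1 + X) ^ (n - hammingNorm c) * (1 - X) ^ hammingNorm c))) =
      (∏ i, if i ∈ T then X * (((binarySign (c i) : ℤ) : ℤ[X]) + -X) else 1) *
        ((1 + X) ^ (n - hammingNorm c) * (1 - X) ^ hammingNorm c) := by
    rw [prod_ite_mem, univ_inter, prod_mul_distrib, prod_const, prod_add, mul_sum, sum_mul]
    refine sum_congr rfl fun U hU => ?_
    rw [prod_const, card_sdiff_of_subset (mem_powerset.1 hU), setSign, Int.cast_prod]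
    ring
  rw [e1, e2, ← prod_one_add_binarySign, ← prod_mul_distrib, ← prod_mul_distrib]
  refine prod_congr rfl fun i _ => ?_
  have hs : ((binarySign (c i) : ℤ) : ℤ[X]) * ((binarySign (c i) : ℤ) : ℤ[X]) = 1 := by
    rw [← Int.cast_mul, binarySign_mul_self, Int.cast_one]
  by_cases hi : i ∈ T
  · simp only [hi, if_true, one_ne_zero, if_false]
    linear_combination (-X * X * (1 + ((binarySign (c i) : ℤ) : ℤ[X]) * X)) * hs
  · simp [hi]

lemma coeff_supersetEnumerator (T : Finset (Fin n)) (w : ℕ) :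
    (supersetEnumerator C T).coeff w =
      ({b ∈ supportDesign C w | T ⊆ b}.ncard : ℤ) := by
  classical
  have : {b ∈ supportDesign C w | T ⊆ b} =
      (((codewords C).filter (fun y => T ⊆ binarySupport y ∧ hammingNorm y = w)).image
        binarySupport : Finset (Finset (Fin n))) := by
    ext b
    simp only [supportDesign, Set.mem_ofPred_eq, coe_image, coe_filter, mem_codewords, Set.mem_image]
    constructor
    · rintro ⟨⟨c, hc, hw, rfl⟩, hb⟩
      exact ⟨c, ⟨hc, hb, hw⟩, rfl⟩
    · rintro ⟨c, ⟨hc, hb, hw⟩, rfl⟩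
      exact ⟨⟨c, hc, hw, rfl⟩, hb⟩
  have hinj : Function.Injective (binarySupport (n := n)) := by
    intro x y hxy
    ext1 i
    have := Finset.ext_iff.1 hxy i
    simp only [binarySupport, mem_filter, mem_univ, true_and] at this
    revert this
    generalize x i = a
    generalize y i = b
    revert a b; decide
  rw [this, Set.ncard_coe_finset, card_image_of_injective _ hinj, supersetEnumerator,
    finsetSum_coeff]
  simp_rw [coeff_X_pow]
  rw [sum_boole, filter_filter]
  simp [eq_comm]

end Generating

/-! ### The design criterion -/

namespace IsThreeWeight

variable {n k d N : ℕ} {C : Submodule (ZMod 2) (Fin n → ZMod 2)}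

/-- A permutation taking T to T' pairs their subsets, and proper subsets cancel by
`weightSum_congr`. Only U = T survives. There the relation between the sums at d and N makes the
three terms a perfect square. -/
lemma supersetEnumerator_sub (h : IsThreeWeight C k d N) {T T' : Finset (Fin n)} (hT : #T = k)
    (hT' : #T' = k) :
    (1 - X ^ 2) ^ k * ((#(codewords C) : ℤ[X]) *
      (supersetEnumerator (dualCode C) T - supersetEnumerator (dualCode C) T')) =
    (1 - X ^ 2) ^ d * (X ^ k * (((weightSum C T d - weightSum C T' d : ℤ) : ℤ[X]) *
      ((1 + X) ^ (N - d) - (1 - X) ^ (N - d)) ^ 2)) := by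
  classical
  have hm := macWilliams_supersetEnumerator C T
  have hm' := macWilliams_supersetEnumerator C T'
  obtain ⟨σ, hσ⟩ := Equiv.Perm.exists_map_finset_eq T T' (hT.trans hT'.symm)
  have hp : T'.powerset = T.powerset.map (mapEmbedding σ.toEmbedding).toEmbedding := by
    rw [← hσ]
    ext U
    simp only [mem_powerset, mem_map, RelEmbedding.coe_toEmbedding, mapEmbedding_apply]
    constructor
    · intro hU
      obtain ⟨V, hV, rfl⟩ := subset_map_iff.1 hU
      exact ⟨V, hV, rfl⟩
    · rintro ⟨V, hV, rfl⟩
      exact map_subset_map.2 hV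
  rw [hp, sum_map] at hm'
  simp only [RelEmbedding.coe_toEmbedding, mapEmbedding_apply, card_map] at hm'
  have hg := fun U => h.sum_setSign_mul (R := ℤ[X]) U (fun u => (1 + X) ^ (n - u) * (1 - X) ^ u)
  simp only [hg, card_map] at hm hm'
  rw [hT] at hm
  rw [hT'] at hm'
  rw [mul_sub, mul_sub, hm, hm', ← mul_sub, ← sum_sub_distrib, sum_eq_single T]
  · have e := h.weightSum_sub hT hT'
    have e' : ((weightSum C T N : ℤ) : ℤ[X]) - ((weightSum C T' N : ℤ) : ℤ[X]) =
        -2 * (((weightSum C T d : ℤ) : ℤ[X]) - ((weightSum C T' d : ℤ) : ℤ[X])) := by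
      exact_mod_cast congrArg (Int.cast : ℤ → ℤ[X]) e
    obtain ⟨p, rfl⟩ := Nat.exists_eq_add_of_lt h.lt
    have hn := h.length_eq
    rw [hT, Nat.sub_self, pow_zero, one_mul, one_mul, h.even.neg_one_pow, hσ,
      show n - d = d + 2 * (p + 1) by omega, show n - (d + p + 1) = d + p + 1 by omega,
      show n - (d + 2 * (p + 1)) = d by omega, show d + p + 1 - d = p + 1 by omega,
      show (1 - X ^ 2 : ℤ[X]) = (1 + X) * (1 - X) by ring, mul_pow]
    push_cast
    linear_combination (X ^ k * (1 + X) ^ (d + p + 1) * (1 - X) ^ (d + p + 1)) * e'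
  · intro U hU hne
    have hlt : #U < k := hT ▸ card_lt_card (ssubset_of_subset_of_ne (mem_powerset.1 hU) hne)
    obtain ⟨e1, e2⟩ := h.weightSum_congr (T := U) (T' := U.map σ.toEmbedding) (by simp) hlt
    rw [e1, e2, sub_self]
  · intro hU
    exact absurd (mem_powerset_self T) hU

/-- A coefficient of an explicit polynomial controls whether the support design of the dual code
is a `k`-design. -/
theorem isDesign (h : IsThreeWeight C k d N) {w : ℕ}
    (hw : k ≤ d → ∀ j, w = k + j →
      ((1 - X ^ 2) ^ (d - k) * ((1 + X) ^ (N - d) - (1 - X) ^ (N - d)) ^ 2 : ℤ[X]).coeff j = 0) :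
    IsDesign k (supportDesign (dualCode C) w) := by
  have hX : (1 - X ^ 2 : ℤ[X]) ≠ 0 := by
    intro h0
    have := congrArg (eval 0) h0
    simp at this
  have hcard : (#(codewords C) : ℤ) ≠ 0 := by
    have := codewords_card_pos C
    omega
  have key : ∀ T T' : Finset (Fin n), #T = k → #T' = k →
      (supersetEnumerator (dualCode C) T).coeff w =
        (supersetEnumerator (dualCode C) T').coeff w := by
    intro T T' hT hT'
    have hs := h.supersetEnumerator_sub hT hT'
    rcases le_or_gt k d with hk | hk
    · have e : (1 - X ^ 2 : ℤ[X]) ^ d = (1 - X ^ 2) ^ k * (1 - X ^ 2) ^ (d - k) := by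
        rw [← pow_add, Nat.add_sub_of_le hk]
      have hs' : (#(codewords C) : ℤ[X]) *
          (supersetEnumerator (dualCode C) T - supersetEnumerator (dualCode C) T') =
          X ^ k * (((weightSum C T d - weightSum C T' d : ℤ) : ℤ[X]) *
            ((1 - X ^ 2) ^ (d - k) * ((1 + X) ^ (N - d) - (1 - X) ^ (N - d)) ^ 2)) := by
        apply mul_left_cancel₀ (pow_ne_zero k hX)
        rw [hs, e]
        ring
      have hc := congrArg (fun p : ℤ[X] => p.coeff w) hs'
      simp only [coeff_natCast_mul, coeff_sub, coeff_X_pow_mul', coeff_intCast_mul,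
        Int.cast_id] at hc
      have h0 : (if k ≤ w then (weightSum C T d - weightSum C T' d) *
          ((1 - X ^ 2) ^ (d - k) * ((1 + X) ^ (N - d) - (1 - X) ^ (N - d)) ^ 2 : ℤ[X]).coeff (w - k)
          else 0) = 0 := by
        split_ifs with hkw
        · rw [hw hk (w - k) (by omega), mul_zero]
        · rfl
      rw [h0] at hc
      rcases mul_eq_zero.1 hc with hc | hc
      · exact absurd hc hcard
      · exact sub_eq_zero.1 hc
    -- When k > d, a factor 1 - X² remains on the left. At X = 1 the left side is therefore zero
    -- while the right side is δ times a power of 2, so δ = 0.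
    · have e : (1 - X ^ 2 : ℤ[X]) ^ k = (1 - X ^ 2) ^ d * (1 - X ^ 2) ^ (k - d) := by
        rw [← pow_add, Nat.add_sub_of_le hk.le]
      rw [e, mul_assoc] at hs
      have hs' := mul_left_cancel₀ (pow_ne_zero d hX) hs
      have hN : N - d ≠ 0 := by have := h.lt; omega
      have hkd : k - d ≠ 0 := by omega
      have hc := congrArg (eval 1) hs'
      simp only [eval_mul, eval_pow, eval_sub, eval_add, eval_one, eval_X, one_pow, sub_self,
        zero_pow hkd, zero_mul, eval_intCast, one_mul, zero_pow hN, sub_zero, Int.cast_id] at hc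
      have hδ : weightSum C T d - weightSum C T' d = 0 := by
        rcases mul_eq_zero.1 hc.symm with hc | hc
        · exact hc
        · exact absurd hc (by positivity)
      rw [hδ, Int.cast_zero, zero_mul, mul_zero] at hs'
      have := (mul_eq_zero.1 hs').resolve_left (pow_ne_zero _ hX)
      have := (mul_eq_zero.1 this).resolve_left (by exact_mod_cast hcard)
      rw [sub_eq_zero.1 this]
  by_cases hT : ∃ T : Finset (Fin n), #T = k
  · obtain ⟨T₀, hT₀⟩ := hT
    refine ⟨w, {b ∈ supportDesign (dualCode C) w | T₀ ⊆ b}.ncard, ?_, fun T hT => ?_⟩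
    · rintro _ ⟨c, _, hc, rfl⟩
      exact hc
    · have := key T T₀ hT hT₀
      rw [coeff_supersetEnumerator, coeff_supersetEnumerator] at this
      exact_mod_cast this
  · refine ⟨w, 0, ?_, fun T hT' => absurd ⟨T, hT'⟩ hT⟩
    rintro _ ⟨c, _, hc, rfl⟩
    exact hc

end IsThreeWeight

/-! ### Coefficients of the design polynomial -/

/-- The even part of `(1 + z) ^ (2 * p)` as a polynomial in `z ^ 2`. -/
noncomputable def evenBinomial (p : ℕ) : ℤ[X] :=
  ∑ j ∈ range (p + 1), C ((2 * p).choose (2 * j) : ℤ) * X ^ j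

lemma coeff_evenBinomial (p j : ℕ) : (evenBinomial p).coeff j = (2 * p).choose (2 * j) := by
  simp only [evenBinomial, finsetSum_coeff, coeff_C_mul_X_pow]
  rw [sum_ite_eq]
  split_ifs with h
  · rfl
  · rw [Nat.choose_eq_zero_of_lt]
    · rfl
    · simp at h; omega

lemma coeff_one_sub_X_pow (m j : ℕ) :
    ((1 - X : ℤ[X]) ^ m).coeff j = (-1) ^ j * (m.choose j : ℤ) := by
  have : (1 - X : ℤ[X]) ^ m = ((1 + X) ^ m).comp (C (-1) * X) := by
    simp [sub_eq_add_neg]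
  rw [this, comp_C_mul_X_coeff, coeff_one_add_X_pow]
  ring

/-- Up to the factor `2` and the substitution `X ↦ X ^ 2`, the polynomial
`(1 - X ^ 2) ^ e * ((1 + X) ^ p - (1 - X) ^ p) ^ 2`. -/
noncomputable def designPoly (e p : ℕ) : ℤ[X] := (1 - X) ^ e * (evenBinomial p - (1 - X) ^ p)

lemma expand_evenBinomial (p : ℕ) :
    2 * expand ℤ 2 (evenBinomial p) = (1 + X) ^ (2 * p) + (1 - X) ^ (2 * p) := by
  ext j
  rw [coeff_ofNat_mul, coeff_expand (by norm_num), coeff_add, coeff_one_add_X_pow,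
    coeff_one_sub_X_pow, coeff_evenBinomial]
  split_ifs with h
  · rw [Nat.mul_div_cancel' h, (even_iff_two_dvd.2 h).neg_one_pow]
    ring
  · rw [(Nat.not_even_iff_odd.1 (fun h' => h h'.two_dvd)).neg_one_pow]
    push_cast
    ring

lemma two_mul_expand_designPoly (e p : ℕ) :
    2 * expand ℤ 2 (designPoly e p) =
      (1 - X ^ 2) ^ e * ((1 + X) ^ p - (1 - X) ^ p) ^ 2 := by
  have h := expand_evenBinomial p
  have h2 : (1 - X ^ 2 : ℤ[X]) ^ p = (1 + X) ^ p * (1 - X) ^ p := by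
    rw [← mul_pow]
    ring
  simp only [designPoly, map_mul, map_sub, map_pow, map_one, expand_X]
  rw [h2]
  linear_combination (1 - X ^ 2) ^ e * h

lemma coeff_evenBinomial_sub (p j : ℕ) : (evenBinomial p - (1 - X) ^ p).coeff j =
    ((2 * p).choose (2 * j) : ℤ) - (-1) ^ j * (p.choose j : ℤ) := by
  rw [coeff_sub, coeff_evenBinomial, coeff_one_sub_X_pow]

lemma choose_succ_mul_cast (m j : ℕ) :
    (m.choose (j + 1) : ℤ) * (j + 1) = m.choose j * (m - j) := by
  rcases le_or_gt j m with h | h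
  · have := Nat.choose_succ_right_eq m j
    rw [← Nat.cast_sub h]
    exact_mod_cast this
  · rw [Nat.choose_eq_zero_of_lt h, Nat.choose_eq_zero_of_lt (by omega)]
    simp

lemma choose_two_mul_cast (m : ℕ) : 2 * (m.choose 2 : ℤ) = m * (m - 1) := by
  have h := choose_succ_mul_cast m 1
  simp only [Nat.choose_one_right] at h
  push_cast at h
  linear_combination h

lemma choose_three_mul_cast (m : ℕ) : 6 * (m.choose 3 : ℤ) = m * (m - 1) * (m - 2) := by
  have h := choose_succ_mul_cast m 2
  push_cast at h
  linear_combination 2 * h + (m - 2 : ℤ) * choose_two_mul_cast m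

lemma choose_four_mul_cast (m : ℕ) : 24 * (m.choose 4 : ℤ) = m * (m - 1) * (m - 2) * (m - 3) := by
  have h := choose_succ_mul_cast m 3
  push_cast at h
  linear_combination 6 * h + (m - 3 : ℤ) * choose_three_mul_cast m

lemma choose_six_mul_cast (m : ℕ) :
    720 * (m.choose 6 : ℤ) = m * (m - 1) * (m - 2) * (m - 3) * (m - 4) * (m - 5) := by
  have h := choose_succ_mul_cast m 4
  have h' := choose_succ_mul_cast m 5
  push_cast at h h'
  linear_combination 120 * h' + 24 * (m - 5 : ℤ) * h +
    (m - 4 : ℤ) * (m - 5 : ℤ) * choose_four_mul_cast m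

lemma coeff_two_designPoly (e p : ℕ) :
    3 * (designPoly e p).coeff 2 = 2 * p ^ 2 * ((p - 1) * (p - 2) - 3 * e) := by
  have h4 := choose_four_mul_cast (2 * p)
  have h2 := choose_two_mul_cast (2 * p)
  have g2 := choose_two_mul_cast p
  push_cast at h4 h2
  have : (designPoly e p).coeff 2 = ((2 * p).choose 4 - p.choose 2 : ℤ) -
      e * ((2 * p).choose 2 + p) := by
    rw [designPoly, coeff_mul]
    simp only [Nat.antidiagonal_succ, coeff_evenBinomial_sub, coeff_one_sub_X_pow]
    simp
    ring
  rw [this]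
  have : 8 * (3 * (((2 * p).choose 4 - p.choose 2 : ℤ) - e * ((2 * p).choose 2 + p)) -
      2 * p ^ 2 * ((p - 1) * (p - 2) - 3 * e)) = 0 := by
    linear_combination h4 - 12 * g2 - 12 * e * h2
  omega

lemma coeff_three_designPoly (e p : ℕ) :
    45 * (designPoly e p).coeff 3 = p ^ 2 * ((p - 1) * (p - 2) * (4 * p ^ 2 - 18 * p + 23) -
      30 * e * ((p - 1) * (p - 2)) + 45 * (e * (e - 1))) := by
  have h6 := choose_six_mul_cast (2 * p)
  have h4 := choose_four_mul_cast (2 * p)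
  have h2 := choose_two_mul_cast (2 * p)
  have g2 := choose_two_mul_cast p
  have g3 := choose_three_mul_cast p
  have e2 := choose_two_mul_cast e
  push_cast at h6 h4 h2
  have : (designPoly e p).coeff 3 = ((2 * p).choose 6 + p.choose 3 : ℤ) -
      e * ((2 * p).choose 4 - p.choose 2 : ℤ) + e.choose 2 * ((2 * p).choose 2 + p) := by
    rw [designPoly, coeff_mul]
    simp only [Nat.antidiagonal_succ, coeff_evenBinomial_sub, coeff_one_sub_X_pow]
    simp
    ring
  rw [this]
  have : 16 * (45 * (((2 * p).choose 6 + p.choose 3 : ℤ) -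
      e * ((2 * p).choose 4 - p.choose 2 : ℤ) + e.choose 2 * ((2 * p).choose 2 + p)) -
      p ^ 2 * ((p - 1) * (p - 2) * (4 * p ^ 2 - 18 * p + 23) -
      30 * e * ((p - 1) * (p - 2)) + 45 * (e * (e - 1)))) = 0 := by
    linear_combination h6 + 120 * g3 - 30 * e * h4 + 360 * e * g2 + 360 * (e.choose 2) * h2 +
      720 * p ^ 2 * e2
  omega

lemma reflect_evenBinomial (p : ℕ) : reflect p (evenBinomial p) = evenBinomial p := by
  ext j
  rw [coeff_reflect, coeff_evenBinomial, coeff_evenBinomial]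
  rcases le_or_gt j p with h | h
  · rw [revAt_le h, ← Nat.choose_symm (show 2 * j ≤ 2 * p by omega)]
    congr 2
    omega
  · rw [revAt_eq_self_of_lt h]

lemma reflect_one_sub_X_pow (m : ℕ) :
    reflect m ((1 - X : ℤ[X]) ^ m) = C ((-1) ^ m) * (1 - X) ^ m := by
  ext j
  rw [coeff_reflect, coeff_C_mul, coeff_one_sub_X_pow, coeff_one_sub_X_pow]
  rcases le_or_gt j m with h | h
  · rw [revAt_le h, Nat.choose_symm h, ← mul_assoc]
    congr 1
    obtain ⟨i, rfl⟩ := Nat.exists_eq_add_of_le h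
    rw [Nat.add_sub_cancel_left, pow_add, mul_right_comm, ← mul_pow]
    simp
  · rw [revAt_eq_self_of_lt h, Nat.choose_eq_zero_of_lt h]
    simp

lemma natDegree_evenBinomial_le (p : ℕ) : (evenBinomial p).natDegree ≤ p := by
  rw [natDegree_le_iff_coeff_eq_zero]
  intro j hj
  rw [coeff_evenBinomial, Nat.choose_eq_zero_of_lt (by omega), Nat.cast_zero]

lemma natDegree_one_sub_X_pow_le (m : ℕ) : ((1 - X : ℤ[X]) ^ m).natDegree ≤ m := by
  rw [natDegree_le_iff_coeff_eq_zero]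
  intro j hj
  rw [coeff_one_sub_X_pow, Nat.choose_eq_zero_of_lt hj, Nat.cast_zero, mul_zero]

/-- Both building blocks are palindromic up to sign. For even p the whole polynomial is too; for odd
p the sign before (1 - X)^p flips, so the top coefficients differ from the bottom ones. -/
lemma reflect_designPoly (e p : ℕ) : reflect (e + p) (designPoly e p) =
    C ((-1) ^ e) * ((1 - X) ^ e * (evenBinomial p - C ((-1) ^ p) * (1 - X) ^ p)) := by
  rw [designPoly, reflect_mul _ _ (natDegree_one_sub_X_pow_le e)
    ((natDegree_sub_le _ _).trans
      (max_le (natDegree_evenBinomial_le p) (natDegree_one_sub_X_pow_le p))),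
    reflect_sub, reflect_evenBinomial, reflect_one_sub_X_pow, reflect_one_sub_X_pow, mul_assoc]

lemma coeff_designPoly_sub_of_even {e p : ℕ} (hp : Even p) {j : ℕ} (hj : j ≤ e + p) :
    (designPoly e p).coeff (e + p - j) = (-1) ^ e * (designPoly e p).coeff j := by
  have h := congrArg (fun q : ℤ[X] => q.coeff j) (reflect_designPoly e p)
  simp only [coeff_reflect, revAt_le hj, coeff_C_mul, hp.neg_one_pow, C_1, one_mul] at h
  exact h

lemma coeff_designPoly_sub_one_of_odd {e p : ℕ} (hp : Odd p) :
    (designPoly e p).coeff (e + p - 1) = (-1) ^ e * (2 * (p * (p - 1) - e)) := by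
  have hj : 1 ≤ e + p := by have := hp.pos; omega
  have h := congrArg (fun q : ℤ[X] => q.coeff 1) (reflect_designPoly e p)
  simp only [coeff_reflect, revAt_le hj, coeff_C_mul, hp.neg_one_pow] at h
  rw [h, coeff_mul]
  have h2 := choose_two_mul_cast (2 * p)
  push_cast at h2
  congr 1
  simp [Nat.antidiagonal_succ, coeff_one_sub_X_pow, coeff_evenBinomial]
  linarith

lemma designPoly_three (e : ℕ) : designPoly e 3 = C 2 * (X * (X + C 3) ^ 2 * (1 - X) ^ e) := by
  have : evenBinomial 3 - (1 - X) ^ 3 = C 2 * (X * (X + C 3) ^ 2) := by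
    simp only [evenBinomial, sum_range_succ, sum_range_zero]
    norm_num [Nat.choose]
    ring
  rw [designPoly, this]
  ring

lemma designPoly_four (e : ℕ) : designPoly e 4 = C 32 * (X * (X + 1) ^ 2 * (1 - X) ^ e) := by
  have : evenBinomial 4 - (1 - X) ^ 4 = C 32 * (X * (X + 1) ^ 2) := by
    simp only [evenBinomial, sum_range_succ, sum_range_zero]
    norm_num [Nat.choose]
    ring
  rw [designPoly, this]
  ring

lemma coeff_X_mul_sq_mul (a : ℤ) (q : ℤ[X]) (j : ℕ) :
    (X * (X + C a) ^ 2 * q).coeff (j + 3) =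
      q.coeff j + 2 * a * q.coeff (j + 1) + a ^ 2 * q.coeff (j + 2) := by
  have : X * (X + C a) ^ 2 * q = q * X ^ 3 + C (2 * a) * (q * X ^ 2) + C (a ^ 2) * (q * X) := by
    simp only [C_mul, C_pow, C_ofNat]
    ring
  rw [this, coeff_add, coeff_add, coeff_C_mul, coeff_C_mul, coeff_mul_X_pow, coeff_mul_X,
    show j + 3 = j + 1 + 2 by ring, coeff_mul_X_pow]

/-- The coefficient combines three consecutive binomials of e. Multiplied by (i + 1)(i + 2), it
becomes a binomial times a quadratic, which is the hypothesis. -/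
lemma coeff_designPoly_three_eq_zero {e i : ℕ}
    (h : (3 * (e + 2 : ℤ) - 4 * (i + 2)) ^ 2 - 9 * (e + 2) + 8 * (i + 2) = 0) :
    (designPoly e 3).coeff (i + 3) = 0 := by
  rw [designPoly_three, coeff_C_mul, coeff_X_mul_sq_mul, coeff_one_sub_X_pow, coeff_one_sub_X_pow,
    coeff_one_sub_X_pow]
  have h1 := choose_succ_mul_cast e i
  have h2 := choose_succ_mul_cast e (i + 1)
  push_cast at h2
  set s : ℤ := (-1) ^ i
  have hs1 : (-1 : ℤ) ^ (i + 1) = -s := by rw [pow_succ]; ring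
  have hs2 : (-1 : ℤ) ^ (i + 2) = s := by rw [pow_add]; ring
  rw [hs1, hs2]
  have : (s * (e.choose i) + 2 * 3 * (-s * e.choose (i + 1)) + 3 ^ 2 * (s * e.choose (i + 2)) : ℤ) *
      ((i + 2) * (i + 1)) = 0 := by
    linear_combination 9 * s * (i + 1) * h2 + (9 * s * (e - i - 1) - 6 * s * (i + 2)) * h1 +
      s * e.choose i * h
  rcases mul_eq_zero.1 this with h' | h'
  · rw [h', mul_zero]
  · exact absurd h' (by positivity)

lemma coeff_designPoly_four_eq_zero {e i : ℕ} (hi : 0 < i)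
    (h : (e + 2 - 2 * i : ℤ) ^ 2 = e + 2) : (designPoly e 4).coeff (i + 1) = 0 := by
  rw [designPoly_four, coeff_C_mul, ← C_1]
  -- The three-term formula starts at index 3, so index 2 is treated by hand; there the hypothesis
  -- forces e = 2.
  obtain rfl | ⟨i, rfl⟩ : i = 1 ∨ ∃ j, i = j + 2 := by
    rcases i with _ | _ | j
    · omega
    · exact Or.inl rfl
    · exact Or.inr ⟨j, rfl⟩
  · have he : e = 2 := by
      have : ((e : ℤ) + 1) * (e - 2) = 0 := by push_cast at h; linear_combination h
      rcases mul_eq_zero.1 this with h' | h' <;> omega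
    subst he
    have : X * (X + C 1) ^ 2 * (C 1 - X) ^ 2 = (X : ℤ[X]) ^ 5 - C 2 * X ^ 3 + X := by
      simp only [C_1, C_ofNat]; ring
    rw [this]
    simp [coeff_X]
  · rw [show i + 2 + 1 = i + 3 by ring, coeff_X_mul_sq_mul, C_1, coeff_one_sub_X_pow,
      coeff_one_sub_X_pow, coeff_one_sub_X_pow]
    have h1 := choose_succ_mul_cast e i
    have h2 := choose_succ_mul_cast e (i + 1)
    push_cast at h2 h
    set s : ℤ := (-1) ^ i
    have hs1 : (-1 : ℤ) ^ (i + 1) = -s := by rw [pow_succ]; ring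
    have hs2 : (-1 : ℤ) ^ (i + 2) = s := by rw [pow_add]; ring
    rw [hs1, hs2]
    have : (s * (e.choose i) + 2 * 1 * (-s * e.choose (i + 1)) +
        1 ^ 2 * (s * e.choose (i + 2)) : ℤ) * ((i + 2) * (i + 1)) = 0 := by
      linear_combination s * (i + 1) * h2 + (s * (e - i - 1) - 2 * s * (i + 2)) * h1 +
        s * e.choose i * h
    rcases mul_eq_zero.1 this with h' | h'
    · rw [h', mul_zero]
    · exact absurd h' (by positivity)

/-! ### Determining the weights of the code -/

section Weights

variable {n d t : ℕ} {C : Submodule (ZMod 2) (Fin n → ZMod 2)}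

/-- The set of weights counted by `IsAssmusMattson`. -/
def innerWeights (C : Submodule (ZMod 2) (Fin n → ZMod 2)) (t : ℕ) : Set ℕ :=
  {u : ℕ | (∃ c ∈ C, hammingNorm c = u) ∧ 0 < u ∧ u + t ≤ n}

lemma exists_weight_sub (h1 : (fun _ => 1) ∈ C) {u : ℕ} (hu : ∃ c ∈ C, hammingNorm c = u) :
    ∃ c ∈ C, hammingNorm c = n - u := by
  obtain ⟨c, hc, rfl⟩ := hu
  exact ⟨c + fun _ => 1, C.add_mem hc h1, hammingNorm_add_one c⟩

lemma HasMinDist.pos (hd : HasMinDist C d) : 0 < d := by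
  obtain ⟨c, _, hc, rfl⟩ := hd.1
  exact hammingNorm_pos_iff.2 hc

lemma HasMinDist.le_of_weight (hd : HasMinDist C d) {u : ℕ} (hu : ∃ c ∈ C, hammingNorm c = u)
    (h0 : 0 < u) : d ≤ u := by
  obtain ⟨c, hc, rfl⟩ := hu
  exact hd.2 ⟨c, hc, hammingNorm_pos_iff.1 h0, rfl⟩

lemma HasMinDist.exists_weight (hd : HasMinDist C d) : ∃ c ∈ C, hammingNorm c = d := by
  obtain ⟨c, hc, _, h⟩ := hd.1
  exact ⟨c, hc, h⟩

lemma IsAssmusMattson.innerWeights_eq (h : IsAssmusMattson C (t + 3) t) :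
    ∃ a b c, a ≠ b ∧ a ≠ c ∧ b ≠ c ∧ innerWeights C t = {a, b, c} := by
  rw [← Set.ncard_eq_three]
  have := h.card_weights
  change _ = ((innerWeights C t).ncard : ℤ) at this
  omega

/-- If `t ≤ d`, then the Assmus–Mattson hypothesis with `d^⊥ = t + 3` forces the nontrivial weights
to be `d`, `n / 2` and `n - d`. -/
lemma IsAssmusMattson.isThreeWeight (hd : HasMinDist C d) (h : IsAssmusMattson C (t + 3) t)
    (htd : t ≤ d) (ht : Even (t + 1)) :
    ∃ N, IsThreeWeight C (t + 1) d N ∧ ∃ c ∈ C, hammingNorm c = N := by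
  obtain ⟨a, b, c, hab, hac, hbc, hS⟩ := h.innerWeights_eq
  have hmem : ∀ u, ((∃ c ∈ C, hammingNorm c = u) ∧ 0 < u ∧ u + t ≤ n) ↔
      (u = a ∨ u = b ∨ u = c) := by
    intro u
    have := Set.ext_iff.1 hS u
    simpa [innerWeights] using this
  have hd0 := hd.pos
  have hsymm : ∀ u, (u = a ∨ u = b ∨ u = c) →
      (n - u = a ∨ n - u = b ∨ n - u = c) ∧ d ≤ u ∧ d ≤ n - u ∧ u ≤ n := by
    intro u hu
    obtain ⟨h1, h2, h3⟩ := (hmem u).2 hu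
    have hdu := hd.le_of_weight h1 h2
    have h4 : 0 < n - u := by
      by_contra h4
      -- Only for t = 0 could the weight n itself be counted, and `ht` excludes this.
      have htn : n = u ∧ t = 0 := by omega
      have : Odd (t + 1) := by rw [htn.2]; exact odd_one
      exact (Nat.not_even_iff_odd.2 this) ht
    have h5 := exists_weight_sub h.one_mem h1
    have h6 := hd.le_of_weight h5 h4
    exact ⟨(hmem _).1 ⟨h5, h4, by omega⟩, hdu, h6, by omega⟩
  have ha := hsymm a (by simp)
  have hb := hsymm b (by simp)
  have hc := hsymm c (by simp)
  have hdd : d = a ∨ d = b ∨ d = c := (hmem d).1 ⟨hd.exists_weight, hd0, by omega⟩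
  have hnd := hsymm d hdd
  obtain ⟨N, hN, hNS, hdN, hall⟩ : ∃ N, n = 2 * N ∧ (N = a ∨ N = b ∨ N = c) ∧ d < N ∧
      ∀ u, (u = a ∨ u = b ∨ u = c) → u = d ∨ u = N ∨ u = n - d := by
    -- The involution u ↦ n - u on a three-element set has a fixed point.
    have : 2 * a = n ∨ 2 * b = n ∨ 2 * c = n := by omega
    rcases this with e | e | e
    · exact ⟨a, by omega, by omega, by omega, by intro u hu; omega⟩
    · exact ⟨b, by omega, by omega, by omega, by intro u hu; omega⟩
    · exact ⟨c, by omega, by omega, by omega, by intro u hu; omega⟩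
  refine ⟨N, ⟨h.one_mem, ?_, hN, hd0, hdN, ht, ?_⟩, ((hmem N).2 hNS).1⟩
  · intro y hy hy0
    exact h.dual_minDist.2 ⟨y, hy, hy0, rfl⟩
  · intro x hx
    have hle := hammingNorm_le_length x
    simp only [mem_insert, mem_singleton]
    by_cases h0 : hammingNorm x = 0
    · exact Or.inl h0
    by_cases hlt : hammingNorm x + t ≤ n
    · have := hall _ ((hmem _).1 ⟨⟨x, hx, rfl⟩, by omega, hlt⟩)
      omega
    · have := exists_weight_sub h.one_mem ⟨x, hx, rfl⟩
      by_cases h5 : 0 < n - hammingNorm x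
      · have := hd.le_of_weight this h5
        omega
      · omega

end Weights

/-! ### Design criteria in terms of k, d and N -/

namespace IsThreeWeight

variable {n k d N : ℕ} {C : Submodule (ZMod 2) (Fin n → ZMod 2)}

lemma weightSum_empty_nonneg (C : Submodule (ZMod 2) (Fin n → ZMod 2)) (u : ℕ) :
    0 ≤ weightSum C ∅ u := by
  simp [weightSum]

/-- If the two weights `d` and `N` have different parities, then `(N - d) ^ 2 ≤ N`. -/
lemma sq_le_of_odd (h : IsThreeWeight C k d N) (hk : 0 < k) (hdC : ∃ c ∈ C, hammingNorm c = d)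
    (hNC : ∃ c ∈ C, hammingNorm c = N) (hodd : Odd (N - d)) : (N - d) ^ 2 ≤ N := by
  have h0 := h.sum_setSign_mul (R := ℤ) ∅ (fun _ => 1)
  have h2 := h.sum_setSign_mul (R := ℤ) ∅ (fun u => ((n : ℤ) - 2 * u) ^ 2)
  have hs := h.sum_setSign_mul (R := ℤ) ∅ (fun u => (-1) ^ u)
  simp only [setSign_empty, Int.cast_one, one_mul, Int.cast_id, card_empty, pow_zero] at h0 h2 hs
  rw [sum_sq_weight C h.le_dual (by omega)] at h2
  have hA := weightSum_empty_nonneg C N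
  have hB := weightSum_empty_nonneg C d
  have hdN := h.lt
  obtain ⟨p, rfl⟩ := Nat.exists_eq_add_of_le hdN.le
  rw [Nat.add_sub_cancel_left] at hodd ⊢
  have hn := h.length_eq
  have hn' : (n : ℤ) = 2 * (d + p) := by omega
  have hnd : ((n - d : ℕ) : ℤ) = d + 2 * p := by omega
  have hne : Even n := ⟨d + p, by omega⟩
  simp only [sum_const, mul_one, nsmul_eq_mul] at h0
  rw [hnd, hn'] at h2
  push_cast at h2
  have hd0 := h.pos
  set A := weightSum C ∅ (d + p)
  set B := weightSum C ∅ d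
  zify
  rcases Nat.even_or_odd d with hde | hdo
  · have hNo : Odd (d + p) := hde.add_odd hodd
    have hnde : Even (n - d) := by
      rw [Nat.even_sub (by omega)]; tauto
    obtain ⟨c, hc, hcw⟩ := hNC
    rw [sum_neg_one_pow_weight C hc (hcw ▸ hNo), hne.neg_one_pow, hde.neg_one_pow,
      hnde.neg_one_pow, hNo.neg_one_pow] at hs
    by_contra! hlt
    have e : A * ((d : ℤ) + p - p ^ 2) = 2 * (d + p) ^ 2 - 2 * p ^ 2 := by
      have hAB : A = 2 + 2 * B := by linarith
      rw [h0, hAB] at h2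
      rw [hAB]
      linarith
    nlinarith [mul_nonneg hA (by linarith : (0 : ℤ) ≤ p ^ 2 - (d + p))]
  · have hNe : Even (d + p) := hdo.add_odd hodd
    have hndo : Odd (n - d) := by
      exact Nat.Even.sub_odd (by omega) hne hdo
    obtain ⟨c, hc, hcw⟩ := hdC
    rw [sum_neg_one_pow_weight C hc (hcw ▸ hdo), hne.neg_one_pow, hdo.neg_one_pow,
      hndo.neg_one_pow, hNe.neg_one_pow] at hs
    by_contra! hlt
    have e : B * ((d : ℤ) + p - p ^ 2) = (d + p) ^ 2 := by
      have hAB : A = 2 * B - 2 := by linarith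
      rw [h0, hAB] at h2
      linarith
    nlinarith [mul_nonneg hB (by linarith : (0 : ℤ) ≤ p ^ 2 - (d + p))]

theorem isDesign_of_designPoly (h : IsThreeWeight C k d N) {w : ℕ}
    (hw : k ≤ d → ∀ i, w = k + 2 * i → (designPoly (d - k) (N - d)).coeff i = 0) :
    IsDesign k (supportDesign (dualCode C) w) := by
  refine h.isDesign fun hk j hj => ?_
  rw [← two_mul_expand_designPoly, coeff_ofNat_mul, coeff_expand (by norm_num)]
  split_ifs with h2
  · rw [hw hk (j / 2) (by omega), mul_zero]
  · rw [mul_zero]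

lemma coeff_two_eq_zero (hlt : d < N) (hk : k ≤ d) (hq : ((N : ℤ) - d) ^ 2 = 3 * N - 3 * k - 2) :
    (designPoly (d - k) (N - d)).coeff 2 = 0 := by
  have := coeff_two_designPoly (d - k) (N - d)
  rw [Nat.cast_sub hk, Nat.cast_sub hlt.le] at this
  have e : ((N : ℤ) - d - 1) * ((N : ℤ) - d - 2) - 3 * ((d : ℤ) - k) = 0 := by
    linear_combination hq
  rw [e, mul_zero] at this
  omega

theorem isDesign_add_four (h : IsThreeWeight C k d N)
    (hq : ((N : ℤ) - d) ^ 2 = 3 * N - 3 * k - 2) :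
    IsDesign k (supportDesign (dualCode C) (k + 4)) := by
  refine h.isDesign_of_designPoly fun hk i hi => ?_
  obtain rfl : i = 2 := by omega
  exact coeff_two_eq_zero h.lt hk hq

theorem isDesign_sub_add_four (h : IsThreeWeight C k d N) (hk0 : 0 < k)
    (hq : ((N : ℤ) - d) ^ 2 = 3 * N - 3 * k - 2) (heven : Even (N - d)) :
    IsDesign k (supportDesign (dualCode C) (n - (k + 4))) := by
  refine h.isDesign_of_designPoly fun hk i hi => ?_
  have hn := h.length_eq
  have hlt := h.lt
  obtain rfl : i = d - k + (N - d) - 2 := by omega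
  rw [coeff_designPoly_sub_of_even heven (by omega), coeff_two_eq_zero h.lt hk hq, mul_zero]

theorem isDesign_sub_add_two (h : IsThreeWeight C k d N) (hk0 : 0 < k)
    (hq : ((N : ℤ) - d) ^ 2 = N - k) (hodd : Odd (N - d)) :
    IsDesign k (supportDesign (dualCode C) (n - (k + 2))) := by
  refine h.isDesign_of_designPoly fun hk i hi => ?_
  have hn := h.length_eq
  have hlt := h.lt
  obtain rfl : i = d - k + (N - d) - 1 := by omega
  rw [coeff_designPoly_sub_one_of_odd hodd, Nat.cast_sub hk, Nat.cast_sub hlt.le]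
  linear_combination (-1) ^ (d - k) * 2 * hq

lemma coeff_three_eq_zero (hlt : d < N) (hk : k ≤ d)
    (hq : ((N : ℤ) - d - 1) * (N - d - 2) * (4 * (N - d) ^ 2 - 18 * (N - d) + 23) -
      30 * (d - k) * ((N - d - 1) * (N - d - 2)) + 45 * ((d - k) * (d - k - 1)) = 0) :
    (designPoly (d - k) (N - d)).coeff 3 = 0 := by
  have := coeff_three_designPoly (d - k) (N - d)
  rw [Nat.cast_sub hk, Nat.cast_sub hlt.le, hq, mul_zero] at this
  omega

theorem isDesign_add_six (h : IsThreeWeight C k d N)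
    (hq : ((N : ℤ) - d - 1) * (N - d - 2) * (4 * (N - d) ^ 2 - 18 * (N - d) + 23) -
      30 * (d - k) * ((N - d - 1) * (N - d - 2)) + 45 * ((d - k) * (d - k - 1)) = 0) :
    IsDesign k (supportDesign (dualCode C) (k + 6)) := by
  refine h.isDesign_of_designPoly fun hk i hi => ?_
  obtain rfl : i = 3 := by omega
  exact coeff_three_eq_zero h.lt hk hq

theorem isDesign_sub_add_six (h : IsThreeWeight C k d N) (hk0 : 0 < k)
    (hq : ((N : ℤ) - d - 1) * (N - d - 2) * (4 * (N - d) ^ 2 - 18 * (N - d) + 23) -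
      30 * (d - k) * ((N - d - 1) * (N - d - 2)) + 45 * ((d - k) * (d - k - 1)) = 0)
    (heven : Odd (N - d) → N < k + 3) :
    IsDesign k (supportDesign (dualCode C) (n - (k + 6))) := by
  refine h.isDesign_of_designPoly fun hk i hi => ?_
  have hn := h.length_eq
  have hlt := h.lt
  -- If N < k + 3, the block size n - (k + 6), truncated at 0, is below k, so no index i exists.
  have he : Even (N - d) := by
    by_contra hne
    have := heven (Nat.not_even_iff_odd.1 hne)
    omega
  obtain rfl : i = d - k + (N - d) - 3 := by omega
  rw [coeff_designPoly_sub_of_even he (by omega), coeff_three_eq_zero h.lt hk hq, mul_zero]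

theorem isDesign_of_sub_eq_three (h : IsThreeWeight C k d N) (hN : N = d + 3) {w : ℕ}
    (hw : k + 6 ≤ w)
    (hq : (3 * (d - k + 2 : ℤ) - 2 * (w - k - 2)) ^ 2 - 9 * (d - k + 2) + 4 * (w - k - 2) = 0) :
    IsDesign k (supportDesign (dualCode C) w) := by
  refine h.isDesign_of_designPoly fun hk i hi => ?_
  obtain ⟨j, rfl⟩ := Nat.exists_eq_add_of_le' (show 3 ≤ i by omega)
  subst hi hN
  rw [Nat.add_sub_cancel_left]
  apply coeff_designPoly_three_eq_zero
  rw [Nat.cast_sub hk]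
  push_cast at hq
  linear_combination hq

theorem isDesign_of_sub_eq_four (h : IsThreeWeight C k d N) (hN : N = d + 4) {w : ℕ}
    (hq : (d + 4 - w : ℤ) ^ 2 = d + 2 - k) :
    IsDesign k (supportDesign (dualCode C) w) := by
  refine h.isDesign_of_designPoly fun hk i hi => ?_
  -- For i ≤ 1 the number d + 4 - w would be at least d + 2 - k ≥ 2, too large for its square to
  -- equal d + 2 - k.
  have hi2 : 2 ≤ i := by
    by_contra hlt
    have : (d : ℤ) + 2 - k ≤ d + 4 - w := by omega
    nlinarith
  obtain ⟨j, rfl⟩ := Nat.exists_eq_add_of_le' (show 1 ≤ i by omega)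
  subst hi hN
  rw [Nat.add_sub_cancel_left]
  apply coeff_designPoly_four_eq_zero (by omega)
  rw [Nat.cast_sub hk]
  push_cast at hq
  linear_combination hq

end IsThreeWeight

/-! ### The exceptional parameters n = 12, d = 2 -/

/-- Here t > d: the weight 10 = n - 2 falls outside the counted range, so the counted weights are 2,
x and 12 - x with 3 ≤ x ≤ 5. The second moment is then too large for x = 3 and x = 4; for x = 5 the
vanishing sum of signs is needed as well. -/
lemma not_isAssmusMattson_twelve {C : Submodule (ZMod 2) (Fin 12 → ZMod 2)}
    (hd : HasMinDist C 2) : ¬ IsAssmusMattson C 6 3 := by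
  intro h
  obtain ⟨a, b, c, hab, hac, hbc, hS⟩ := h.innerWeights_eq
  have hmem : ∀ u, ((∃ c ∈ C, hammingNorm c = u) ∧ 0 < u ∧ u + 3 ≤ 12) ↔
      (u = a ∨ u = b ∨ u = c) := by
    intro u
    have := Set.ext_iff.1 hS u
    simpa [innerWeights] using this
  have hsymm : ∀ u, (u = a ∨ u = b ∨ u = c) → 2 ≤ u ∧ u ≤ 9 ∧
      (u ≠ 2 → 12 - u = a ∨ 12 - u = b ∨ 12 - u = c) := by
    intro u hu
    obtain ⟨h1, h2, h3⟩ := (hmem u).2 hu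
    have hdu := hd.le_of_weight h1 h2
    exact ⟨hdu, by omega, fun h4 => (hmem _).1
      ⟨exists_weight_sub h.one_mem h1, by omega, by omega⟩⟩
  have ha := hsymm a (by simp)
  have hb := hsymm b (by simp)
  have hc := hsymm c (by simp)
  have h2 : 2 = a ∨ 2 = b ∨ 2 = c := (hmem 2).1 ⟨hd.exists_weight, by omega, by omega⟩
  obtain ⟨x, hx3, hx5, hxS, hxall⟩ : ∃ x, 3 ≤ x ∧ x ≤ 5 ∧ (x = a ∨ x = b ∨ x = c) ∧
      ∀ u, (u = a ∨ u = b ∨ u = c) → u = 2 ∨ u = x ∨ u = 12 - x := by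
    have : (3 ≤ a ∧ a ≤ 5) ∨ (3 ≤ b ∧ b ≤ 5) ∨ (3 ≤ c ∧ c ≤ 5) := by omega
    rcases this with e | e | e
    · exact ⟨a, e.1, e.2, by omega, by intro u hu; omega⟩
    · exact ⟨b, e.1, e.2, by omega, by intro u hu; omega⟩
    · exact ⟨c, e.1, e.2, by omega, by intro u hu; omega⟩
  have hwt : ∀ y ∈ codewords C, hammingNorm y ∈ ({0, 2, x, 12 - x, 10, 12} : Finset ℕ) := by
    intro y hy
    rw [mem_codewords] at hy
    have hle := hammingNorm_le_length y
    simp only [mem_insert, mem_singleton]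
    by_cases h0 : hammingNorm y = 0
    · exact Or.inl h0
    by_cases hlt : hammingNorm y + 3 ≤ 12
    · have := hxall _ ((hmem _).1 ⟨⟨y, hy, rfl⟩, by omega, hlt⟩)
      omega
    · have := exists_weight_sub h.one_mem ⟨y, hy, rfl⟩
      by_cases h5 : 0 < 12 - hammingNorm y
      · have := hd.le_of_weight this h5
        omega
      · omega
  have hsum : ∀ f : ℕ → ℤ, ∑ y ∈ codewords C, f (hammingNorm y) =
      f 0 + f 12 + weightSum C ∅ 2 * (f 2 + f 10) + weightSum C ∅ x * (f x + f (12 - x)) := by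
    intro f
    rw [← sum_fiberwise_of_maps_to hwt]
    have key : ∀ u, ∑ y ∈ (codewords C).filter (fun y => hammingNorm y = u),
        f (hammingNorm y) = weightSum C ∅ u * f u := by
      intro u
      rw [weightSum, sum_mul]
      refine sum_congr rfl fun y hy => ?_
      rw [(mem_filter.1 hy).2, setSign_empty, one_mul]
    simp_rw [key]
    rw [sum_insert, sum_insert, sum_insert, sum_insert, sum_insert, sum_singleton]
    · have e0 := weightSum_compl C h.one_mem ∅ (u := 0) (by omega)
      have e2 := weightSum_compl C h.one_mem ∅ (u := 2) (by omega)
      have ex := weightSum_compl C h.one_mem ∅ (u := x) (by omega)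
      simp only [Nat.sub_zero, Nat.reduceSub, card_empty, pow_zero, one_mul] at e0 e2 ex
      rw [e0, e2, ex, weightSum_zero]
      ring
    all_goals simp only [mem_insert, mem_singleton]; omega
  have hA := IsThreeWeight.weightSum_empty_nonneg C 2
  have hB := IsThreeWeight.weightSum_empty_nonneg C x
  have h0 := hsum (fun _ => 1)
  have hq := hsum (fun u => (((12 : ℕ) : ℤ) - 2 * u) ^ 2)
  have hs := hsum (fun u => (-1) ^ u)
  rw [sum_sq_weight C (fun y hy hy0 => h.dual_minDist.2 ⟨y, hy, hy0, rfl⟩) (by norm_num)] at hq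
  simp only [sum_const, mul_one, nsmul_eq_mul] at h0
  have hodd : Odd x → ∑ y ∈ codewords C, (-1 : ℤ) ^ hammingNorm y = 0 := by
    intro hx
    obtain ⟨y, hy, hyw⟩ := ((hmem x).2 hxS).1
    exact sum_neg_one_pow_weight C hy (hyw ▸ hx)
  interval_cases x
  · norm_num at hq; omega
  · norm_num at hq; omega
  · rw [hodd (by decide)] at hs
    norm_num at hq hs; omega

/-! ### Assembling the cases -/

lemma even_sub_of_sq {d N a : ℕ} (hlt : d < N) {b : ℤ} (hq : ((N : ℤ) - d) ^ 2 = a * N - 2 * b)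
    (ha : Odd a) : Even (N - d) ↔ Even N := by
  have h1 := congrArg Even hq
  simp only [Int.even_pow', ne_eq, OfNat.ofNat_ne_zero, not_false_eq_true, Int.even_sub,
    Int.even_mul, Int.even_coe_nat, even_two, true_or, iff_true, Nat.not_even_iff_odd.2 ha,
    false_or] at h1
  rw [Nat.even_sub hlt.le]
  tauto

/-- The designs obtained when `(d^⊥, t) = (4, 1)`. -/
theorem IsAssmusMattson.parts_four_one {n d : ℕ} {C : Submodule (ZMod 2) (Fin n → ZMod 2)}
    (hd : HasMinDist C d) (h : IsAssmusMattson C 4 1) :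
      ((n : ℤ) ^ 2 - (4 * d + 6) * n + 4 * d ^ 2 + 32 = 0 →
        (n % 4 = 0 → IsDesign 2 (supportDesign (dualCode C) 6) ∧
          IsDesign 2 (supportDesign (dualCode C) (n - 6))) ∧
        (n % 4 = 2 → IsDesign 2 (supportDesign (dualCode C) 6))) ∧
      (n % 4 = 2 → d % 2 = 0 → (n : ℤ) ^ 2 - (4 * d + 2) * n + 4 * d ^ 2 + 8 = 0 →
        IsDesign 2 (supportDesign (dualCode C) (n - 4))) ∧
      ((n : ℤ) ^ 4 - (8 * d + 15) * n ^ 3 + (12 * d * (2 * d + 5) + 145) * n ^ 2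
          - 2 * (2 * d * (d * (8 * d + 15) + 100) + 285) * n
          + 16 * (d ^ 4 + 25 * d ^ 2 + 109) = 0 →
        IsDesign 2 (supportDesign (dualCode C) 8) ∧
        IsDesign 2 (supportDesign (dualCode C) (n - 8))) ∧
      ((n : ℤ) - 2 * d = 6 → ∀ u : ℝ, 0 < u →
        (u = (3 * d - 9 + √(3 * d + 1)) / 4 ∨ u = (3 * d - 9 - √(3 * d + 1)) / 4) →
        ∀ w : ℕ, (w : ℝ) = 2 * u + 8 → IsDesign 2 (supportDesign (dualCode C) w)) ∧
      ((n : ℤ) - 2 * d = 8 → ∀ s : ℕ, s ^ 2 = d →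
        IsDesign 2 (supportDesign (dualCode C) (d + 4 + s)) ∧
        IsDesign 2 (supportDesign (dualCode C) (d + 4 - s))) := by
  obtain ⟨N, hW, hNC⟩ := h.isThreeWeight hd hd.pos (by decide)
  have hdC := hd.exists_weight
  have hn := hW.length_eq
  have hlt := hW.lt
  have hn' : (n : ℤ) = 2 * N := by omega
  refine ⟨fun hq => ?_, fun h4 hd2 hq => ?_, fun hq => ?_, fun h6 u hu hu' w hw => ?_,
    fun h8 s hs => ?_⟩
  · rw [hn'] at hq
    have hq' : ((N : ℤ) - d) ^ 2 = 3 * N - 3 * (1 + 1 : ℕ) - 2 := by push_cast; linarith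
    refine ⟨fun h4 => ⟨hW.isDesign_add_four hq', hW.isDesign_sub_add_four (by norm_num) hq' ?_⟩,
      fun _ => hW.isDesign_add_four hq'⟩
    rw [even_sub_of_sq (a := 3) (b := 4) hlt (by push_cast at hq' ⊢; linarith) (by decide),
      Nat.even_iff]
    omega
  · rw [hn'] at hq
    refine hW.isDesign_sub_add_two (by norm_num) (by push_cast; linarith) ?_
    rw [Nat.odd_iff]
    omega
  · rw [hn'] at hq
    have hq' : ((N : ℤ) - d - 1) * (N - d - 2) * (4 * (N - d) ^ 2 - 18 * (N - d) + 23) -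
        30 * (d - (1 + 1 : ℕ)) * ((N - d - 1) * (N - d - 2)) +
        45 * ((d - (1 + 1 : ℕ)) * (d - (1 + 1 : ℕ) - 1)) = 0 := by
      push_cast
      linarith
    refine ⟨hW.isDesign_add_six hq', hW.isDesign_sub_add_six (by norm_num) hq' fun hodd => ?_⟩
    have hle := hW.sq_le_of_odd (by norm_num) hdC hNC hodd
    obtain ⟨p, rfl⟩ := Nat.exists_eq_add_of_le' hlt.le
    rw [Nat.add_sub_cancel] at hle hodd
    set N := p + d with hNd
    have hd' : (d : ℤ) = N - p := by omega
    rw [hd'] at hq'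
    -- In the variables N and p = N - d the quartic involves p only through p².
    have hq2 : 4 * ((p : ℤ) ^ 2) ^ 2 - 30 * N * p ^ 2 + 100 * p ^ 2 + 45 * N ^ 2 - 285 * N +
        436 = 0 := by
      push_cast at hq'
      linear_combination hq'
    clear_value N
    by_contra! hN
    rcases Nat.lt_or_ge N 6 with h6 | h6
    · have : N = 5 := by omega
      subst this
      have hp2 : p ≤ 2 := by nlinarith
      interval_cases p <;> first | exact absurd hodd (by decide) | norm_num at hq2
    -- On p² ≤ N the expression is at least its value 19N² - 185N + 436 at p² = N, which is positive
    -- from N = 6 on.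
    · zify at hle h6
      nlinarith [mul_nonneg (sub_nonneg.2 hle) (by nlinarith : (0 : ℤ) ≤ 26 * N - 4 * p ^ 2 - 100)]
  · have hr : (0 : ℝ) ≤ 3 * d + 1 := by positivity
    have hsq := Real.sq_sqrt hr
    have h8 : 8 < w := by
      have : (8 : ℝ) < w := by linarith
      exact_mod_cast this
    refine hW.isDesign_of_sub_eq_three (by omega) (by omega) ?_
    have : (3 * (d - 2 + 2 : ℝ) - 2 * (w - 2 - 2)) ^ 2 - 9 * (d - 2 + 2) + 4 * (w - 2 - 2) = 0 := by
      rw [hw]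
      rcases hu' with rfl | rfl <;> linear_combination hsq
    exact_mod_cast this
  · have hs' : (s : ℤ) ^ 2 = d := by exact_mod_cast hs
    have hsd : s ≤ d + 4 := by nlinarith
    refine ⟨hW.isDesign_of_sub_eq_four (by omega) ?_, hW.isDesign_of_sub_eq_four (by omega) ?_⟩
    · push_cast
      linear_combination hs'
    · rw [Nat.cast_sub hsd]
      push_cast
      linear_combination hs'

/-- The designs obtained when `(d^⊥, t) = (6, 3)` and `3 ≤ d`. -/
theorem IsAssmusMattson.parts_six_three {n d : ℕ} {C : Submodule (ZMod 2) (Fin n → ZMod 2)}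
    (hd : HasMinDist C d) (hd3 : 3 ≤ d) (h : IsAssmusMattson C 6 3) :
      ((n : ℤ) ^ 2 - (4 * d + 6) * n + 4 * d ^ 2 + 56 = 0 →
        (n % 4 = 0 → IsDesign 4 (supportDesign (dualCode C) 8) ∧
          IsDesign 4 (supportDesign (dualCode C) (n - 8))) ∧
        (n % 4 = 2 → IsDesign 4 (supportDesign (dualCode C) 8))) ∧
      (n % 4 = 2 → d % 2 = 0 → (n : ℤ) ^ 2 - (4 * d + 2) * n + 4 * d ^ 2 + 16 = 0 →
        IsDesign 4 (supportDesign (dualCode C) (n - 6))) ∧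
      ((n : ℤ) ^ 4 - (8 * d + 15) * n ^ 3 + (12 * d * (2 * d + 5) + 205) * n ^ 2
          - 4 * d * (d * (8 * d + 15) + 160) * n - 930 * n
          + 16 * d ^ 2 * (d ^ 2 + 40) + 4744 = 0 →
        IsDesign 4 (supportDesign (dualCode C) 10) ∧
        IsDesign 4 (supportDesign (dualCode C) (n - 10))) ∧
      ((n : ℤ) - 2 * d = 6 → ∀ u : ℝ, 0 < u →
        (u = (3 * d - 15 + √(3 * d - 5)) / 4 ∨ u = (3 * d - 15 - √(3 * d - 5)) / 4) →
        ∀ w : ℕ, (w : ℝ) = 2 * u + 10 → IsDesign 4 (supportDesign (dualCode C) w)) ∧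
      ((n : ℤ) - 2 * d = 8 → ∀ s : ℕ, (s : ℤ) ^ 2 = (d : ℤ) - 2 →
        IsDesign 4 (supportDesign (dualCode C) (d + 4 + s)) ∧
        IsDesign 4 (supportDesign (dualCode C) (d + 4 - s))) := by
  obtain ⟨N, hW, hNC⟩ := h.isThreeWeight hd hd3 (by decide)
  have hdC := hd.exists_weight
  have hn := hW.length_eq
  have hlt := hW.lt
  have hn' : (n : ℤ) = 2 * N := by omega
  refine ⟨fun hq => ?_, fun h4 hd2 hq => ?_, fun hq => ?_, fun h6 u hu hu' w hw => ?_,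
    fun h8 s hs => ?_⟩
  · rw [hn'] at hq
    have hq' : ((N : ℤ) - d) ^ 2 = 3 * N - 3 * (3 + 1 : ℕ) - 2 := by push_cast; linarith
    refine ⟨fun h4 => ⟨hW.isDesign_add_four hq', hW.isDesign_sub_add_four (by norm_num) hq' ?_⟩,
      fun _ => hW.isDesign_add_four hq'⟩
    rw [even_sub_of_sq (a := 3) (b := 7) hlt (by push_cast at hq' ⊢; linarith) (by decide),
      Nat.even_iff]
    omega
  · rw [hn'] at hq
    refine hW.isDesign_sub_add_two (by norm_num) (by push_cast; linarith) ?_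
    rw [Nat.odd_iff]
    omega
  · rw [hn'] at hq
    have hq' : ((N : ℤ) - d - 1) * (N - d - 2) * (4 * (N - d) ^ 2 - 18 * (N - d) + 23) -
        30 * (d - (3 + 1 : ℕ)) * ((N - d - 1) * (N - d - 2)) +
        45 * ((d - (3 + 1 : ℕ)) * (d - (3 + 1 : ℕ) - 1)) = 0 := by
      push_cast
      linarith
    refine ⟨hW.isDesign_add_six hq', hW.isDesign_sub_add_six (by norm_num) hq' fun hodd => ?_⟩
    have hle := hW.sq_le_of_odd (by norm_num) hdC hNC hodd
    obtain ⟨p, rfl⟩ := Nat.exists_eq_add_of_le' hlt.le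
    rw [Nat.add_sub_cancel] at hle hodd
    set N := p + d with hNd
    have hd' : (d : ℤ) = N - p := by omega
    rw [hd'] at hq'
    have hq2 : 4 * ((p : ℤ) ^ 2) ^ 2 - 30 * N * p ^ 2 + 160 * p ^ 2 + 45 * N ^ 2 - 465 * N +
        1186 = 0 := by
      push_cast at hq'
      linear_combination hq'
    clear_value N
    by_contra! hN
    rcases Nat.lt_or_ge N 10 with h6 | h6
    · have hp2 : p ≤ 3 := by nlinarith
      interval_cases N <;> interval_cases p <;>
        first | exact absurd hodd (by decide) | norm_num at hq2
    -- The value at p² = N is now 19N² - 305N + 1186, positive from N = 10 on; the range 7 ≤ N ≤ 9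
    -- is checked directly above.
    · zify at hle h6
      nlinarith [mul_nonneg (sub_nonneg.2 hle) (by nlinarith : (0 : ℤ) ≤ 26 * N - 4 * p ^ 2 - 160)]
  · have hr : (0 : ℝ) ≤ 3 * d - 5 := by
      have : (3 : ℝ) ≤ d := by exact_mod_cast hd3
      linarith
    have hsq := Real.sq_sqrt hr
    have h8 : 10 < w := by
      have : (10 : ℝ) < w := by linarith
      exact_mod_cast this
    refine hW.isDesign_of_sub_eq_three (by omega) (by omega) ?_
    have : (3 * (d - 4 + 2 : ℝ) - 2 * (w - 4 - 2)) ^ 2 - 9 * (d - 4 + 2) + 4 * (w - 4 - 2) = 0 := by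
      rw [hw]
      rcases hu' with rfl | rfl <;> linear_combination hsq
    exact_mod_cast this
  · have hsd : s ≤ d + 4 := by nlinarith
    refine ⟨hW.isDesign_of_sub_eq_four (by omega) ?_, hW.isDesign_of_sub_eq_four (by omega) ?_⟩
    · push_cast
      linear_combination hs
    · rw [Nat.cast_sub hsd]
      push_cast
      linear_combination hs

theorem proposition4p2 {n d : ℕ} (C : Submodule (ZMod 2) (Fin n → ZMod 2))
    (hd : HasMinDist C d) :
    -- the case `(d^⊥, t) = (4, 1)`
    (IsAssmusMattson C 4 1 →
      ((n : ℤ) ^ 2 - (4 * d + 6) * n + 4 * d ^ 2 + 32 = 0 →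
        (n % 4 = 0 → IsDesign 2 (supportDesign (dualCode C) 6) ∧
          IsDesign 2 (supportDesign (dualCode C) (n - 6))) ∧
        (n % 4 = 2 → IsDesign 2 (supportDesign (dualCode C) 6))) ∧
      (n % 4 = 2 → d % 2 = 0 → (n : ℤ) ^ 2 - (4 * d + 2) * n + 4 * d ^ 2 + 8 = 0 →
        IsDesign 2 (supportDesign (dualCode C) (n - 4))) ∧
      ((n : ℤ) ^ 4 - (8 * d + 15) * n ^ 3 + (12 * d * (2 * d + 5) + 145) * n ^ 2
          - 2 * (2 * d * (d * (8 * d + 15) + 100) + 285) * n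
          + 16 * (d ^ 4 + 25 * d ^ 2 + 109) = 0 →
        IsDesign 2 (supportDesign (dualCode C) 8) ∧
        IsDesign 2 (supportDesign (dualCode C) (n - 8))) ∧
      ((n : ℤ) - 2 * d = 6 → ∀ u : ℝ, 0 < u →
        (u = (3 * d - 9 + √(3 * d + 1)) / 4 ∨ u = (3 * d - 9 - √(3 * d + 1)) / 4) →
        ∀ w : ℕ, (w : ℝ) = 2 * u + 8 → IsDesign 2 (supportDesign (dualCode C) w)) ∧
      ((n : ℤ) - 2 * d = 8 → ∀ s : ℕ, s ^ 2 = d →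
        IsDesign 2 (supportDesign (dualCode C) (d + 4 + s)) ∧
        IsDesign 2 (supportDesign (dualCode C) (d + 4 - s)))) ∧
    -- the case `(d^⊥, t) = (6, 3)`
    (IsAssmusMattson C 6 3 →
      ((n : ℤ) ^ 2 - (4 * d + 6) * n + 4 * d ^ 2 + 56 = 0 →
        (n % 4 = 0 → IsDesign 4 (supportDesign (dualCode C) 8) ∧
          IsDesign 4 (supportDesign (dualCode C) (n - 8))) ∧
        (n % 4 = 2 → IsDesign 4 (supportDesign (dualCode C) 8))) ∧
      (n % 4 = 2 → d % 2 = 0 → (n : ℤ) ^ 2 - (4 * d + 2) * n + 4 * d ^ 2 + 16 = 0 →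
        IsDesign 4 (supportDesign (dualCode C) (n - 6))) ∧
      ((n : ℤ) ^ 4 - (8 * d + 15) * n ^ 3 + (12 * d * (2 * d + 5) + 205) * n ^ 2
          - 4 * d * (d * (8 * d + 15) + 160) * n - 930 * n
          + 16 * d ^ 2 * (d ^ 2 + 40) + 4744 = 0 →
        IsDesign 4 (supportDesign (dualCode C) 10) ∧
        IsDesign 4 (supportDesign (dualCode C) (n - 10))) ∧
      ((n : ℤ) - 2 * d = 6 → ∀ u : ℝ, 0 < u →
        (u = (3 * d - 15 + √(3 * d - 5)) / 4 ∨ u = (3 * d - 15 - √(3 * d - 5)) / 4) →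
        ∀ w : ℕ, (w : ℝ) = 2 * u + 10 → IsDesign 4 (supportDesign (dualCode C) w)) ∧
      ((n : ℤ) - 2 * d = 8 → ∀ s : ℕ, (s : ℤ) ^ 2 = (d : ℤ) - 2 →
        IsDesign 4 (supportDesign (dualCode C) (d + 4 + s)) ∧
        IsDesign 4 (supportDesign (dualCode C) (d + 4 - s)))) := by
  refine ⟨fun h => ?_, fun h => ?_⟩
  · exact h.parts_four_one hd
  · rcases Nat.lt_or_ge 2 d with hd3 | hd3
    · exact h.parts_six_three hd hd3
    have hd0 := hd.pos
    -- For d ≤ 2 the equations in (1) have no integer solution n, and no admissible u is positive.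
    -- Only n = 12, d = 2 has to be excluded by the code itself.
    refine ⟨fun hq => ?_, fun _ _ hq => ?_, fun hq => ?_, fun _ u hu hu' => ?_, fun h8 s hs => ?_⟩
    · interval_cases d <;> push_cast at hq
      · nlinarith [sq_nonneg ((n : ℤ) - 5)]
      · nlinarith [sq_nonneg ((n : ℤ) - 7)]
    · interval_cases d <;> push_cast at hq
      · nlinarith [sq_nonneg ((n : ℤ) - 3)]
      · nlinarith [sq_nonneg ((n : ℤ) - 5)]
    · obtain ⟨m, hm⟩ : ∃ m : ℤ, m = n - 2 * d := ⟨_, rfl⟩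
      have hm' : (n : ℤ) = m + 2 * d := by omega
      rw [hm'] at hq
      interval_cases d <;> push_cast at hq
      · nlinarith [sq_nonneg (2 * m ^ 2 - 15 * m + 40), sq_nonneg (m - 4)]
      · nlinarith [sq_nonneg (2 * m ^ 2 - 15 * m + 40), sq_nonneg (m - 4)]
    · exfalso
      interval_cases d
      -- For d = 1 the radicand is negative and the real square root takes its default value 0, so u
      -- = -3.
      · have : √(3 * ((1 : ℕ) : ℝ) - 5) = 0 := Real.sqrt_eq_zero_of_nonpos (by norm_num)
        rw [this] at hu'
        rcases hu' with rfl | rfl <;> norm_num at hu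
      · have : √(3 * ((2 : ℕ) : ℝ) - 5) = 1 := by norm_num
        rw [this] at hu'
        rcases hu' with rfl | rfl <;> norm_num at hu
    · have hd2 : d = 2 := by nlinarith [sq_nonneg (s : ℤ)]
      subst hd2
      obtain rfl : n = 12 := by omega
      exact absurd h (not_isAssmusMattson_twelve hd)
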